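/- Let $m,l,r$ be non-negative integers, let $W$ be a random vector in $\mathbb{R}^m$, let $W_1,W_2,\dots$ be i.i.d. copies of $W$, and let $P_n=\frac1n\sum_{i=1}^n\delta_{W_i}$ be the empirical distribution. Let $h:\mathbb{R}^m\times\mathbb{R}^l\to\mathbb{R}^r$ and $\theta_*\in\mathbb{R}^l$. For $\rho\in[1,\infty)$ and $q\in[1,\infty]$ let $c(u,w)=\|u-w\|_q^\rho$, let $p\in[1,\infty]$ satisfy $1/p+1/q=1$, and for probability measures $P,Q$ on $\mathbb{R}^m$ let $$D_c(P,Q)=\inf\{E_\pi[c(U,V)]:\ \pi \text{ a probability law of } (U,V) \text{ on } \mathbb{R}^m\times\mathbb{R}^m,\ U\sim P,\ V\sim Q\}.$$ The robust Wasserstein profile function at $\theta_*$ is $$R_n(\theta_*;\rho)=\inf\{D_c(P,P_n):\ P \text{ a probability measure on } \mathbb{R}^m,\ h(\cdot,\theta_*) \text{ is } P\text{-integrable},\ E_P[h(W,\theta_*)]=\mathbf 0\}.$$ Assume that 1. $E[h(W,\theta_*)]=\mathbf 0$ and $E\|h(W,\theta_*)\|_2^2<\infty$; 2. $w\mapsto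 h(w,\theta_*)$ is continuously differentiable, with Jacobian matrix $D_wh(w,\theta_*)\in\mathbb{R}^{r\times m}$; 3. $P(\|\zeta^TD_wh(W,\theta_*)\|_p>0)>0$ for every $\zeta\in\mathbb{R}^r\setminus\{\mathbf 0\}$. Let $H\sim\mathcal N(\mathbf 0,\mathrm{Cov}[h(W,\theta_*)])$, where $\mathrm{Cov}[h(W,\theta_*)]=E[h(W,\theta_*)h(W,\theta_*)^T]$, and define $$\bar R(\rho)=\max_{\zeta\in\mathbb{R}^r}\Big\{\rho\,\zeta^TH-(\rho-1)\,E\big\|\zeta^TD_wh(W,\theta_*)\big\|_p^{\rho/(\rho-1)}\Big\}\quad\text{if }\rho>1,$$ $$\bar R(1)=\max\big\{\zeta^TH:\ \zeta\in\mathbb{R}^r,\ P(\|\zeta^TD_wh(W,\theta_*)\|_p>1)=0\big\}\quad\text{if }\rho=1,$$ where the expectation (over $W$, for fixed $\zeta$) may be $+\infty$, in which case the expression in braces is $-\infty$. Then $R_n(\theta_*;\rho)$, for $n\ge1$, and $\bar R(\rho)$ are finite-valued random variables, the maxima are attained for every value of $H$, and, as $n\to\infty$, $n^{\rho/2}R_n(\theta_*;\rho)$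 is asymptotically stochastically bounded above by $\bar R(\rho)$: for every continuous, bounded, non-decreasing $f:\mathbb{R}\to\mathbb{R}$, $$\limsup_{n\to\infty}E\big[f\big(n^{\rho/2}R_n(\theta_*;\rho)\big)\big]\le E\big[f\big(\bar R(\rho)\big)\big].$$ -/

import Mathlib

open MeasureTheory ProbabilityTheory Filter
open scoped ENNReal

noncomputable section

namespace RWP

/-- The `ℓ_q` norm on `ℝ^k`, for `q ∈ [1, ∞]` (the maximum norm for `q = ∞`). -/
def ellNorm (q : ℝ≥0∞) {k : ℕ} (x : Fin k → ℝ) : ℝ := ‖WithLp.toLp q x‖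

/-- The cost `c(u, w) = ‖u - w‖_q ^ ρ` on `ℝ^m`. -/
def normCost (q : ℝ≥0∞) (ρ : ℝ) {m : ℕ} (u w : EuclideanSpace ℝ (Fin m)) : ℝ≥0∞ :=
  ENNReal.ofReal (ellNorm q (u - w).ofLp ^ ρ)

/-- The optimal transport cost `D_c(P, Q)`: the infimum of `E_π[c(U, W)]` over all joint
probability laws `π` of `(U, W)` with `U ∼ P` and `W ∼ Q`. -/
def transportCost {E : Type*} [MeasurableSpace E] (c : E → E → ℝ≥0∞) (P Q : Measure E) : ℝ≥0∞ :=
  ⨅ (π : Measure (E × E)) (_ : IsProbabilityMeasure π) (_ : π.map Prod.fst = P)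
    (_ : π.map Prod.snd = Q), ∫⁻ z, c z.1 z.2 ∂π

/-- The empirical distribution `P_n = n⁻¹ ∑_{i < n} δ_{x_i}`. -/
def empirical {E : Type*} [MeasurableSpace E] (x : ℕ → E) (n : ℕ) : Measure E :=
  (n : ℝ≥0∞)⁻¹ • ∑ i ∈ Finset.range n, Measure.dirac (x i)

/-- The profile value `inf {D_c(P, Q) : E_P[g(W)] = 0}`, where `P` runs over the probability
measures under which `g` is integrable. -/
def profile {E F : Type*} [MeasurableSpace E] [NormedAddCommGroup F] [NormedSpace ℝ F]
    (c : E → E → ℝ≥0∞) (g : E → F) (Q : Measure E) : ℝ≥0∞ :=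
  ⨅ (P : Measure E) (_ : IsProbabilityMeasure P) (_ : Integrable g P) (_ : ∫ w, g w ∂P = 0),
    transportCost c P Q

/-- The robust Wasserstein profile function `R_n(θ; ρ)` of the estimating function `h` for the
sample `x_0, …, x_{n-1}` and the cost `‖u - w‖_q ^ ρ`. -/
def rwp (q : ℝ≥0∞) (ρ : ℝ) {m l r : ℕ}
    (h : EuclideanSpace ℝ (Fin m) → EuclideanSpace ℝ (Fin l) → EuclideanSpace ℝ (Fin r))
    (x : ℕ → EuclideanSpace ℝ (Fin m)) (n : ℕ) (θ : EuclideanSpace ℝ (Fin l)) : ℝ≥0∞ :=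
  profile (normCost q ρ) (fun w => h w θ) (empirical x n)

/-- The `r × m` Jacobian matrix `D g(w)` of `g : ℝ^m → ℝ^r`. -/
def jacobian {m r : ℕ} (g : EuclideanSpace ℝ (Fin m) → EuclideanSpace ℝ (Fin r))
    (w : EuclideanSpace ℝ (Fin m)) : Matrix (Fin r) (Fin m) ℝ :=
  Matrix.of fun i j => fderiv ℝ g w (EuclideanSpace.single j 1) i

/-- `‖ζᵀ A‖_p` for a vector `ζ ∈ ℝ^r` and an `r × m` matrix `A`. -/
def rowNorm (p : ℝ≥0∞) {m r : ℕ} (ζ : EuclideanSpace ℝ (Fin r)) (A : Matrix (Fin r) (Fin m) ℝ) :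
    ℝ :=
  ellNorm p (Matrix.vecMul ζ.ofLp A)

/-- The covariance matrix of a random vector. -/
def covMat {Ω : Type*} [MeasurableSpace Ω] (μ : Measure Ω) {r : ℕ}
    (Y : Ω → EuclideanSpace ℝ (Fin r)) : Matrix (Fin r) (Fin r) ℝ :=
  Matrix.of fun i j => cov[fun ω => Y ω i, fun ω => Y ω j; μ]

/-- The objective `ρ ζᵀx - (ρ - 1) E‖ζᵀ A‖_p ^ (ρ / (ρ - 1))` for a random matrix `A`; it is `-∞`
when the expectation is infinite. -/
def objective {Ω : Type*} [MeasurableSpace Ω] (μ : Measure Ω) (p : ℝ≥0∞) (ρ : ℝ) {m r : ℕ}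
    (A : Ω → Matrix (Fin r) (Fin m) ℝ) (x ζ : EuclideanSpace ℝ (Fin r)) : EReal :=
  ((ρ * inner ℝ ζ x : ℝ) : EReal) -
    ((ENNReal.ofReal (ρ - 1) *
      ∫⁻ ω, ENNReal.ofReal (rowNorm p ζ (A ω) ^ (ρ / (ρ - 1))) ∂μ : ℝ≥0∞) : EReal)

/-- The admissible set `{ζ : P(‖ζᵀ A‖_p > 1) = 0}` for a random matrix `A`. -/
def admissible {Ω : Type*} [MeasurableSpace Ω] (μ : Measure Ω) (p : ℝ≥0∞) {m r : ℕ}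
    (A : Ω → Matrix (Fin r) (Fin m) ℝ) : Set (EuclideanSpace ℝ (Fin r)) :=
  {ζ | μ {ω | 1 < rowNorm p ζ (A ω)} = 0}

/-- The value of the limiting variable `R̄(ρ)` at `H = x`. -/
def rbar {Ω : Type*} [MeasurableSpace Ω] (μ : Measure Ω) (p : ℝ≥0∞) (ρ : ℝ) {m r : ℕ}
    (A : Ω → Matrix (Fin r) (Fin m) ℝ) (x : EuclideanSpace ℝ (Fin r)) : ℝ :=
  if ρ = 1 then sSup ((fun ζ => inner ℝ ζ x) '' admissible μ p A)
  else (⨆ ζ, objective μ p ρ A x ζ).toReal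

/-- The asymptotic stochastic upper bound `Y_n ≲_D Z`:
`limsup E[f(Y_n)] ≤ E[f(Z)]` for every continuous bounded non-decreasing `f`. -/
def AsympStochLE {Ω Ω' : Type*} [MeasurableSpace Ω] [MeasurableSpace Ω'] (μ : Measure Ω)
    (ν : Measure Ω') (Y : ℕ → Ω → ℝ) (Z : Ω' → ℝ) : Prop :=
  ∀ f : ℝ → ℝ, Continuous f → (∃ C, ∀ t, |f t| ≤ C) → Monotone f →
    limsup (fun n => ∫ ω, f (Y n ω) ∂μ) atTop ≤ ∫ ω, f (Z ω) ∂ν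

end RWP

end

noncomputable section

namespace RWP

/-! Write g for h(·, θ) and S_n for n^{-1/2} ∑ g(X_i). Moving each sample point to X_i - Δ(X_i)/√n,
with Δ a bounded measurable field vanishing outside a ball, changes ∑ g(X_i) by about -n^{1/2}
E[Dg(W)Δ(W)], and the n^{ρ/2}-rescaled transport cost is about E‖Δ(W)‖_q^ρ. Hence the natural limit
bound is v(S_n), where v(y) is the least cost E‖Δ(W)‖_q^ρ subject to E[Dg(W)Δ(W)] = y.

The function v is the primal form of R̄. Non-degeneracy makes the response Δ ↦ E[Dg(W)Δ(W)] onto ℝ^r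
(`response_surjective`), so v is a finite convex function, hence continuous, and has a subgradient
everywhere. The subgradient is an optimal dual variable, and testing it on fields that are extremal
in Hölder's and Young's inequalities identifies the dual problem with the maximum defining R̄
(`rbar_eq_valueFn`). Attainment, finiteness and measurability of R̄ follow together.

The moved sample must satisfy the estimating equation exactly, not just to first order. Near a given
y, take affinely independent points b_k around y where v is at most slightly above v(y), and fields
Δ_k with responses b_k. By the strong law the empirical responses of the Δ_k converge to the b_k, so
their convex hull still contains a ball around y. When S_n lies in it, S_n is a convex combination
of them, and splitting the mass of every sample point among the moves Δ_k with those weights solves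
the equation with no remainder (`rpow_mul_profile_le`, `exists_nhds_ae_eventually_le`). Compactness
extends this to S_n in any compact set, and the central limit theorem for S_n, with tightness, gives
the stochastic bound. -/

lemma holderConjugate_of_one_div {p q : ℝ≥0∞} (hpq : 1 / p + 1 / q = 1) : p.HolderConjugate q := by
  rw [ENNReal.holderConjugate_iff]; simpa using hpq

/-! ### ℓ_q norms and extremal vectors in Hölder's inequality -/

section ellNorm

variable {k : ℕ}

lemma ellNorm_nonneg (q : ℝ≥0∞) [Fact (1 ≤ q)] (x : Fin k → ℝ) : 0 ≤ ellNorm q x := norm_nonneg _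

lemma ellNorm_zero (q : ℝ≥0∞) [Fact (1 ≤ q)] : ellNorm q (0 : Fin k → ℝ) = 0 :=
  norm_zero (E := PiLp q fun _ : Fin k => ℝ)

lemma ellNorm_eq_zero (q : ℝ≥0∞) [Fact (1 ≤ q)] {x : Fin k → ℝ} : ellNorm q x = 0 ↔ x = 0 := by
  simp [ellNorm]

lemma ellNorm_add_le (q : ℝ≥0∞) [Fact (1 ≤ q)] (x y : Fin k → ℝ) :
    ellNorm q (x + y) ≤ ellNorm q x + ellNorm q y := by
  simpa only [ellNorm, WithLp.toLp_add] using
    norm_add_le (WithLp.toLp q x : PiLp q fun _ : Fin k => ℝ) (WithLp.toLp q y)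

lemma ellNorm_smul (q : ℝ≥0∞) [Fact (1 ≤ q)] (t : ℝ) (x : Fin k → ℝ) :
    ellNorm q (t • x) = |t| * ellNorm q x := by
  simp only [ellNorm, WithLp.toLp_smul, norm_smul, Real.norm_eq_abs]

lemma continuous_ellNorm (q : ℝ≥0∞) [Fact (1 ≤ q)] :
    Continuous (fun x : Fin k → ℝ => ellNorm q x) := by
  unfold ellNorm; fun_prop

lemma exists_ellNorm_le (q : ℝ≥0∞) [Fact (1 ≤ q)] (k : ℕ) :
    ∃ C : ℝ, 0 ≤ C ∧ ∀ x : EuclideanSpace ℝ (Fin k), ellNorm q x.ofLp ≤ C * ‖x‖ := by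
  let T : EuclideanSpace ℝ (Fin k) →ₗ[ℝ] PiLp q (fun _ : Fin k => ℝ) :=
    (WithLp.linearEquiv 2 ℝ (Fin k → ℝ)).trans (WithLp.linearEquiv q ℝ (Fin k → ℝ)).symm
  exact ⟨‖T.toContinuousLinearMap‖, norm_nonneg _, fun x => T.toContinuousLinearMap.le_opNorm x⟩

lemma exists_norm_le_ellNorm (q : ℝ≥0∞) [Fact (1 ≤ q)] (k : ℕ) :
    ∃ C : ℝ, 0 ≤ C ∧ ∀ x : EuclideanSpace ℝ (Fin k), ‖x‖ ≤ C * ellNorm q x.ofLp := by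
  let T : PiLp q (fun _ : Fin k => ℝ) →ₗ[ℝ] EuclideanSpace ℝ (Fin k) :=
    (WithLp.linearEquiv q ℝ (Fin k → ℝ)).trans (WithLp.linearEquiv 2 ℝ (Fin k → ℝ)).symm
  exact ⟨‖T.toContinuousLinearMap‖, norm_nonneg _,
    fun x => T.toContinuousLinearMap.le_opNorm (WithLp.toLp q x.ofLp)⟩

lemma ellNorm_one_eq (x : Fin k → ℝ) : ellNorm 1 x = ∑ i, |x i| := by
  rw [ellNorm, PiLp.norm_eq_sum (by simp)]; simp

lemma ellNorm_top_eq (x : Fin k → ℝ) : ellNorm ∞ x = ⨆ i, |x i| := by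
  simp [ellNorm, PiLp.norm_eq_ciSup]

lemma ellNorm_eq_sum {p : ℝ≥0∞} (hp : 0 < p.toReal) (x : Fin k → ℝ) :
    ellNorm p x = (∑ i, |x i| ^ p.toReal) ^ (1 / p.toReal) := by
  simp [ellNorm, PiLp.norm_eq_sum hp]

lemma ellNorm_top_le {x : Fin k → ℝ} {C : ℝ} (hC : 0 ≤ C) (h : ∀ i, |x i| ≤ C) :
    ellNorm ∞ x ≤ C := by
  rw [ellNorm_top_eq]; exact Real.iSup_le h hC

lemma abs_le_ellNorm (q : ℝ≥0∞) [Fact (1 ≤ q)] (x : Fin k → ℝ) (i : Fin k) :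
    |x i| ≤ ellNorm q x :=
  PiLp.norm_apply_le (WithLp.toLp q x) i

/-- Hölder's inequality. -/
lemma sum_mul_le_ellNorm_mul (p q : ℝ≥0∞) [hpq : p.HolderConjugate q] (a x : Fin k → ℝ) :
    ∑ i, a i * x i ≤ ellNorm p a * ellNorm q x := by
  have aux : ∀ a x : Fin k → ℝ, ∑ i, a i * x i ≤ ellNorm 1 a * ellNorm ∞ x := by
    intro a x
    rw [ellNorm_one_eq, Finset.sum_mul]
    refine Finset.sum_le_sum fun i _ => (le_abs_self _).trans ?_
    rw [abs_mul]
    gcongr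
    exact abs_le_ellNorm ∞ x i
  rcases eq_or_ne p 1 with rfl | hp1
  · obtain rfl : q = ∞ := (ENNReal.HolderConjugate.eq_top_iff_eq_one q 1).2 rfl
    exact aux a x
  rcases eq_or_ne p ∞ with rfl | hp2
  · obtain rfl : q = 1 := (ENNReal.HolderConjugate.eq_top_iff_eq_one ∞ q).1 rfl
    simpa [mul_comm] using aux x a
  have h1 : 1 < p := lt_of_le_of_ne (ENNReal.HolderConjugate.one_le p q) hp1.symm
  have h1' : 1 < p.toReal := by
    simpa using (ENNReal.toReal_lt_toReal ENNReal.one_ne_top hp2).2 h1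
  have hc : p.toReal.HolderConjugate q.toReal := ENNReal.HolderConjugate.toReal h1'
  rw [ellNorm_eq_sum hc.pos, ellNorm_eq_sum hc.symm.pos]
  exact Real.inner_le_Lp_mul_Lq _ _ _ hc

lemma abs_eq_mul_sign (x : ℝ) : x * SignType.sign x = |x| := by
  rcases lt_trichotomy x 0 with h | h | h <;> simp [h, abs_of_neg, abs_of_pos]

lemma abs_sign_le (x : ℝ) : |((SignType.sign x : SignType) : ℝ)| ≤ 1 := by
  rcases lt_trichotomy x 0 with h | rfl | h <;> simp [*]

lemma measurable_sign : Measurable fun x : ℝ => ((SignType.sign x : SignType) : ℝ) := by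
  have : (fun x : ℝ => ((SignType.sign x : SignType) : ℝ)) =
      fun x => if 0 < x then 1 else if x < 0 then -1 else 0 := by
    ext x
    rcases lt_trichotomy x 0 with h | h | h <;> simp [h, h.le]
  rw [this]
  exact Measurable.ite measurableSet_Ioi measurable_const
    (Measurable.ite measurableSet_Iio measurable_const measurable_const)

/-- A measurable selection of extremal vectors in Hölder's inequality. -/
lemma exists_measurable_dual (p q : ℝ≥0∞) [hpq : p.HolderConjugate q] (k : ℕ) :
    ∃ d : (Fin k → ℝ) → (Fin k → ℝ), Measurable d ∧ (∀ a, ellNorm q (d a) ≤ 1) ∧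
      ∀ a, ∑ i, a i * d a i = ellNorm p a := by
  have sgn : ∀ i : Fin k, Measurable fun a : Fin k → ℝ => ((SignType.sign (a i) : SignType) : ℝ) :=
    fun i => measurable_sign.comp (measurable_pi_apply i)
  rcases eq_or_ne p 1 with rfl | hp1
  · obtain rfl : q = ∞ := (ENNReal.HolderConjugate.eq_top_iff_eq_one q 1).2 rfl
    refine ⟨fun a i => SignType.sign (a i), measurable_pi_lambda _ sgn, fun a => ?_, fun a => ?_⟩
    · exact ellNorm_top_le zero_le_one fun i => abs_sign_le _
    · simp [ellNorm_one_eq]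
  rcases eq_or_ne p ∞ with rfl | hp2
  · obtain rfl : q = 1 := (ENNReal.HolderConjugate.eq_top_iff_eq_one ∞ q).1 rfl
    -- Equal weight goes to all coordinates of maximal modulus; spreading over the ties avoids
    -- selecting an index and keeps the map measurable.
    let c : (Fin k → ℝ) → Fin k → ℝ := fun a i => if |a i| = ellNorm ∞ a then 1 else 0
    have hc : ∀ i, Measurable fun a => c a i := fun i =>
      Measurable.ite (measurableSet_eq_fun (by fun_prop) (continuous_ellNorm ∞).measurable)
        measurable_const measurable_const
    have hc0 : ∀ a i, 0 ≤ c a i := fun a i => by simp only [c]; split_ifs <;> simp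
    have hm : ∀ a i, c a i * |a i| = c a i * ellNorm ∞ a := fun a i => by
      simp only [c]; split_ifs with h <;> simp [h]
    refine ⟨fun a i => c a i * SignType.sign (a i) / ∑ j, c a j,
      measurable_pi_lambda _ fun i => ((hc i).mul (sgn i)).div
        (Finset.measurable_sum _ fun j _ => hc j), fun a => ?_, fun a => ?_⟩
    · rw [ellNorm_one_eq]
      have hs : 0 ≤ ∑ j, c a j := Finset.sum_nonneg fun j _ => hc0 a j
      calc ∑ i, |c a i * SignType.sign (a i) / ∑ j, c a j|
          ≤ ∑ i, c a i / ∑ j, c a j := by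
            refine Finset.sum_le_sum fun i _ => ?_
            rw [abs_div, abs_mul, abs_of_nonneg hs, abs_of_nonneg (hc0 a i)]
            gcongr
            exact mul_le_of_le_one_right (hc0 a i) (abs_sign_le _)
        _ ≤ 1 := by
            rw [← Finset.sum_div]; exact div_self_le_one _
    · rcases Nat.eq_zero_or_pos k with rfl | hk
      · simp [ellNorm_top_eq]
      have : Nonempty (Fin k) := ⟨⟨0, hk⟩⟩
      obtain ⟨j, hj⟩ := exists_eq_ciSup_of_finite (f := fun i => |a i|)
      rw [← ellNorm_top_eq] at hj
      have hs : 0 < ∑ j, c a j :=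
        Finset.sum_pos' (fun j _ => hc0 a j) ⟨j, Finset.mem_univ _, by simp [c, hj]⟩
      have : ∀ i, a i * (c a i * SignType.sign (a i) / ∑ j, c a j) =
          c a i * ellNorm ∞ a / ∑ j, c a j := fun i => by
        rw [← hm, ← abs_eq_mul_sign]; ring
      simp only [this]
      rw [← Finset.sum_div, ← Finset.sum_mul]
      field_simp
  have h1 : 1 < p := lt_of_le_of_ne (ENNReal.HolderConjugate.one_le p q) hp1.symm
  have h1' : 1 < p.toReal := by
    simpa using (ENNReal.toReal_lt_toReal ENNReal.one_ne_top hp2).2 h1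
  have hc : p.toReal.HolderConjugate q.toReal := ENNReal.HolderConjugate.toReal h1'
  have : Fact (1 ≤ p) := ⟨h1.le⟩
  have : Fact (1 ≤ q) := ⟨ENNReal.HolderConjugate.one_le q p⟩
  set s := p.toReal with hs
  -- This is the equality case of Hölder, normalized to unit ℓ_q norm. At a = 0 the sign factor
  -- makes the vector zero, whatever the quotient.
  refine ⟨fun a i => SignType.sign (a i) * (|a i| / ellNorm p a) ^ (s - 1),
    measurable_pi_lambda _ fun i => (sgn i).mul
      (((by fun_prop : Measurable fun a : Fin k → ℝ => |a i|).div
        (continuous_ellNorm p).measurable).pow_const _), fun a => ?_, fun a => ?_⟩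
  all_goals
    rcases eq_or_ne a 0 with rfl | ha
    · simp [ellNorm_zero, ← Pi.zero_def]
    have hN : 0 < ellNorm p a :=
      lt_of_le_of_ne (ellNorm_nonneg p a) fun h => ha ((ellNorm_eq_zero p).1 h.symm)
    have hsum : ∑ i, |a i| ^ s = ellNorm p a ^ s := by
      rw [ellNorm_eq_sum hc.pos, ← Real.rpow_mul (by positivity), ← hs,
        one_div_mul_cancel hc.pos.ne', Real.rpow_one]
  · rw [ellNorm_eq_sum hc.symm.pos]
    refine Real.rpow_le_one (by positivity) ?_ (by positivity)
    calc ∑ i, |(SignType.sign (a i) : ℝ) * (|a i| / ellNorm p a) ^ (s - 1)| ^ q.toReal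
        ≤ ∑ i, |a i| ^ s / ellNorm p a ^ s := by
          refine Finset.sum_le_sum fun i _ => ?_
          have h0 : 0 ≤ (|a i| / ellNorm p a) ^ (s - 1) := by positivity
          rw [abs_mul, abs_of_nonneg h0]
          calc (|(SignType.sign (a i) : ℝ)| * (|a i| / ellNorm p a) ^ (s - 1)) ^ q.toReal
              ≤ ((|a i| / ellNorm p a) ^ (s - 1)) ^ q.toReal := by
                refine Real.rpow_le_rpow (by positivity) ?_ hc.symm.pos.le
                exact mul_le_of_le_one_left h0 (abs_sign_le _)
            _ = |a i| ^ s / ellNorm p a ^ s := by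
                rw [← Real.rpow_mul (by positivity), hc.sub_one_mul_conj,
                  Real.div_rpow (abs_nonneg _) hN.le]
      _ = 1 := by rw [← Finset.sum_div, hsum, div_self (by positivity)]
  · have : ∀ i, a i * ((SignType.sign (a i) : ℝ) * (|a i| / ellNorm p a) ^ (s - 1)) =
        |a i| ^ s / ellNorm p a ^ (s - 1) := fun i => by
      rw [← mul_assoc, abs_eq_mul_sign, Real.div_rpow (abs_nonneg _) hN.le]
      rcases eq_or_ne (a i) 0 with h | h
      · simp [h, hc.pos.ne']
      · rw [mul_div_assoc', mul_comm, ← Real.rpow_add_one (abs_pos.2 h).ne']; simp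
    simp only [this]
    rw [← Finset.sum_div, hsum, ← Real.rpow_sub hN]
    simp

end ellNorm

/-! ### The Jacobian as a directional derivative -/

section jacobian

variable {m r : ℕ} {g : EuclideanSpace ℝ (Fin m) → EuclideanSpace ℝ (Fin r)}

lemma inner_fderiv_eq_sum (w x : EuclideanSpace ℝ (Fin m)) (ζ : EuclideanSpace ℝ (Fin r)) :
    inner ℝ ζ (fderiv ℝ g w x) =
      ∑ j, Matrix.vecMul ζ.ofLp (jacobian g w) j * x.ofLp j := by
  have hx : x = ∑ j, x.ofLp j • EuclideanSpace.single j (1 : ℝ) := by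
    ext i; simp [Finset.sum_apply, Pi.single_apply]
  conv_lhs => rw [hx]
  rw [map_sum, inner_sum]
  refine Finset.sum_congr rfl fun j _ => ?_
  rw [map_smul, inner_smul_right, mul_comm]
  simp [Matrix.vecMul, dotProduct, jacobian, PiLp.inner_apply, mul_comm]

lemma continuous_vecMul_jacobian (hg : ContDiff ℝ 1 g) (ζ : EuclideanSpace ℝ (Fin r)) :
    Continuous fun w => Matrix.vecMul ζ.ofLp (jacobian g w) := by
  refine continuous_pi fun j => ?_
  have h : Continuous (fderiv ℝ g) := hg.continuous_fderiv one_ne_zero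
  simp only [Matrix.vecMul, dotProduct, jacobian, Matrix.of_apply]
  fun_prop

lemma continuous_rowNorm_jacobian (p : ℝ≥0∞) [Fact (1 ≤ p)] (hg : ContDiff ℝ 1 g)
    (ζ : EuclideanSpace ℝ (Fin r)) : Continuous fun w => rowNorm p ζ (jacobian g w) :=
  (continuous_ellNorm p).comp (continuous_vecMul_jacobian hg ζ)

lemma inner_fderiv_le (p q : ℝ≥0∞) [p.HolderConjugate q] (w x : EuclideanSpace ℝ (Fin m))
    (ζ : EuclideanSpace ℝ (Fin r)) :
    inner ℝ ζ (fderiv ℝ g w x) ≤ rowNorm p ζ (jacobian g w) * ellNorm q x.ofLp := by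
  rw [inner_fderiv_eq_sum]
  exact sum_mul_le_ellNorm_mul p q _ _

end jacobian

/-! ### Convex analysis: separation, subgradients and value functions -/

section Convex

variable {F : Type*} [NormedAddCommGroup F] [InnerProductSpace ℝ F]

/-- A finite convex function on a finite-dimensional space has a subgradient at every point. -/
lemma exists_subgradient [FiniteDimensional ℝ F] {f : F → ℝ} (hf : ConvexOn ℝ Set.univ f) (y : F) :
    ∃ η : F, ∀ z, f y + inner ℝ η (z - y) ≤ f z := by
  have hc : Continuous f := continuousOn_univ.1 (hf.continuousOn isOpen_univ)
  have hopen : IsOpen {x : F × ℝ | x.1 ∈ Set.univ ∧ f x.1 < x.2} := by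
    simpa using isOpen_lt (hc.comp continuous_fst) continuous_snd
  obtain ⟨φ, hφ⟩ := geometric_hahn_banach_open_point hf.convex_strict_epigraph hopen
    (x := (y, f y)) (by simp)
  have hsplit : ∀ (x : F) (t : ℝ), φ (x, t) = φ (x, 0) + t * φ (0, 1) := fun x t => by
    rw [← smul_eq_mul, ← map_smul, ← map_add]; simp
  -- The separating hyperplane is not vertical, because the strict epigraph contains a point
  -- directly above (y, f y). It is therefore the graph of an affine minorant of f.
  have hβ : φ (0, 1) < 0 := by
    have := hφ (y, f y + 1) (by simp)
    rw [hsplit, hsplit y (f y)] at this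
    linarith
  set β := -φ (0, 1) with hβdef
  have hβ0 : 0 < β := by simp [hβdef, hβ]
  let ψ : StrongDual ℝ F := φ.comp (ContinuousLinearMap.inl ℝ F ℝ)
  refine ⟨β⁻¹ • (InnerProductSpace.toDual ℝ F).symm ψ, fun z => ?_⟩
  have key : ψ (z - y) ≤ β * (f z - f y) := by
    have h1 : ∀ t, f z < t → ψ z - β * t < ψ y - β * f y := fun t ht => by
      have := hφ (z, t) (by simpa using ht)
      rw [hsplit, hsplit y (f y)] at this
      simp only [ψ, ContinuousLinearMap.comp_apply, ContinuousLinearMap.inl_apply]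
      rw [hβdef]; linarith
    have h2 : ψ z - β * f z ≤ ψ y - β * f y := by
      refine le_of_forall_pos_lt_add fun ε hε => ?_
      have := h1 (f z + ε / β) (by linarith [div_pos hε hβ0])
      rw [mul_add, mul_div_cancel₀ _ hβ0.ne'] at this
      linarith
    rw [map_sub]; linarith
  rw [inner_smul_left, InnerProductSpace.toDual_symm_apply]
  simp only [conj_trivial]
  have : β⁻¹ * ψ (z - y) ≤ f z - f y := by
    rw [inv_mul_le_iff₀ hβ0]; exact key
  linarith

/-- A point outside a convex set is weakly separated from it by a nonzero functional. -/
lemma exists_inner_nonpos_of_notMem [FiniteDimensional ℝ F] {K : Set F} (hK : Convex ℝ K)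
    (hne : K.Nonempty) (h0 : (0 : F) ∉ K) : ∃ u : F, u ≠ 0 ∧ ∀ k ∈ K, inner ℝ u k ≤ 0 := by
  by_cases hint : (interior K).Nonempty
  · obtain ⟨φ, hφ0, hφ⟩ := geometric_hahn_banach_of_nonempty_interior_point hK
      (fun h => h0 (interior_subset h)) hint
    exact ⟨(InnerProductSpace.toDual ℝ F).symm φ, by simpa using hφ0, fun k hk => by
      simpa [InnerProductSpace.toDual_symm_apply] using hφ k hk⟩
  -- With empty interior, K lies in a proper affine subspace; a normal vector is constant on K, and
  -- its sign can be chosen.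
  · obtain ⟨k₀, hk₀⟩ := hne
    have hspan : affineSpan ℝ K ≠ ⊤ := fun h => hint (by
      rwa [← hK.convexHull_eq, interior_convexHull_nonempty_iff_affineSpan_eq_top])
    have hdir : (affineSpan ℝ K).direction ≠ ⊤ := fun h => hspan
      ((AffineSubspace.direction_eq_top_iff_of_nonempty
        ⟨k₀, subset_affineSpan ℝ K hk₀⟩).1 h)
    rw [Ne, ← Submodule.orthogonal_eq_bot_iff] at hdir
    obtain ⟨u, hu, hu0⟩ := Submodule.exists_mem_ne_zero_of_ne_bot hdir
    have hconst : ∀ k ∈ K, inner ℝ u k = inner ℝ u k₀ := fun k hk => by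
      have := (Submodule.mem_orthogonal' _ _).1 hu (k - k₀)
        (AffineSubspace.vsub_mem_direction (subset_affineSpan ℝ K hk) (subset_affineSpan ℝ K hk₀))
      rwa [inner_sub_right, sub_eq_zero] at this
    rcases le_total (inner ℝ u k₀) 0 with h | h
    · exact ⟨u, hu0, fun k hk => (hconst k hk).trans_le h⟩
    · exact ⟨-u, neg_ne_zero.2 hu0, fun k hk => by rw [inner_neg_left, hconst k hk]; linarith⟩

/-- Convex hulls of finitely many points are stable under small perturbations. -/
lemma exists_ball_subset_convexHull [FiniteDimensional ℝ F] {ι : Type*} [Finite ι] (b : ι → F) {y : F}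
    (hy : y ∈ interior (convexHull ℝ (Set.range b))) :
    ∃ δ > 0, ∀ v : ι → F, (∀ k, ‖v k - b k‖ ≤ δ) →
      Metric.ball y δ ⊆ convexHull ℝ (Set.range v) := by
  obtain ⟨ε, hε, hball⟩ := Metric.isOpen_iff.1 isOpen_interior y hy
  -- If u separates z from the perturbed hull, the original hull exceeds ⟨u, z⟩ by at most ‖u‖ε/3.
  -- But it contains the point at distance 2ε/3 from y in direction u, while ⟨u, z - y⟩ < ‖u‖ε/3: a
  -- contradiction.
  refine ⟨ε / 3, by positivity, fun v hv z hz => ?_⟩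
  by_contra hzn
  obtain ⟨φ, s, hs, hsz⟩ := geometric_hahn_banach_closed_point (convex_convexHull ℝ (Set.range v))
    ((Set.finite_range v).isClosed_convexHull ℝ) hzn
  set u := (InnerProductSpace.toDual ℝ F).symm φ with hu
  have hφ : ∀ x, φ x = inner ℝ u x := fun x => by rw [hu, InnerProductSpace.toDual_symm_apply]
  have hb : ∀ x ∈ convexHull ℝ (Set.range b), inner ℝ u x ≤ inner ℝ u z + ‖u‖ * (ε / 3) := by
    intro x hx
    refine convexHull_min (t := {x | inner ℝ u x ≤ inner ℝ u z + ‖u‖ * (ε / 3)}) ?_ ?_ hx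
    · rintro _ ⟨k, rfl⟩
      have h1 := hs (v k) (subset_convexHull ℝ _ ⟨k, rfl⟩)
      rw [hφ] at h1 hsz
      have h2 : inner ℝ u (b k - v k) ≤ ‖u‖ * (ε / 3) :=
        (real_inner_le_norm _ _).trans (by gcongr; rw [norm_sub_rev]; exact hv k)
      rw [inner_sub_right] at h2
      simp only [Set.mem_ofPred_eq]; linarith
    · exact convex_halfSpace_le (f := fun x => inner ℝ u x)
        ⟨fun x y => inner_add_right _ _ _, fun c x => inner_smul_right _ _ _⟩ _
  have hu0 : 0 < ‖u‖ := by
    refine norm_pos_iff.2 fun h => ?_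
    have h1 : ∀ x, φ x = 0 := fun x => by rw [hφ, h, inner_zero_left]
    have hne : Nonempty ι := by
      by_contra hne
      rw [not_nonempty_iff] at hne
      simp [Set.range_eq_empty] at hy
    obtain ⟨k⟩ := hne
    have h2 := hs (v k) (subset_convexHull ℝ _ ⟨k, rfl⟩)
    rw [h1] at h2 hsz
    linarith
  have hx := hb (y + (2 * ε / 3) • (‖u‖⁻¹ • u)) (interior_subset (hball (by
    rw [Metric.mem_ball, dist_self_add_left, norm_smul, norm_smul, norm_inv, norm_norm,
      inv_mul_cancel₀ hu0.ne', Real.norm_of_nonneg (by positivity)]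
    linarith)))
  have hz' : inner ℝ u (z - y) < ‖u‖ * (ε / 3) :=
    (real_inner_le_norm _ _).trans_lt (by gcongr; rwa [← dist_eq_norm])
  rw [inner_add_right, inner_smul_right, inner_smul_right, real_inner_self_eq_norm_sq] at hx
  rw [inner_sub_right] at hz'
  have : 2 * ε / 3 * (‖u‖⁻¹ * ‖u‖ ^ 2) = 2 * (‖u‖ * (ε / 3)) := by field_simp
  linarith

variable {V : Type*} [AddCommGroup V] [Module ℝ V]

/-- The optimal value `inf {c x : L x = y}` of a linearly constrained minimization problem. -/
def valueFn (L : V →ₗ[ℝ] F) (c : V → ℝ) (y : F) : ℝ := sInf (c '' (L ⁻¹' {y}))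

variable {L : V →ₗ[ℝ] F} {c : V → ℝ}

lemma valueFn_le (hc0 : ∀ x, 0 ≤ c x) (x : V) : valueFn L c (L x) ≤ c x :=
  csInf_le ⟨0, by rintro _ ⟨x, -, rfl⟩; exact hc0 x⟩ ⟨x, rfl, rfl⟩

lemma exists_lt_of_valueFn_lt (hL : Function.Surjective L) {y : F} {a : ℝ}
    (h : valueFn L c y < a) : ∃ x, L x = y ∧ c x < a := by
  obtain ⟨x₀, hx₀⟩ := hL y
  obtain ⟨_, ⟨x, hx, rfl⟩, hlt⟩ := exists_lt_of_csInf_lt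
    (s := c '' (L ⁻¹' {y})) ⟨c x₀, x₀, hx₀, rfl⟩ h
  exact ⟨x, hx, hlt⟩

lemma le_valueFn (hL : Function.Surjective L) {y : F} {a : ℝ} (h : ∀ x, L x = y → a ≤ c x) :
    a ≤ valueFn L c y := by
  obtain ⟨x₀, hx₀⟩ := hL y
  refine le_csInf ⟨c x₀, x₀, hx₀, rfl⟩ ?_
  rintro _ ⟨x, hx, rfl⟩
  exact h x hx

/-- Near-minimizers for y and z combine to a feasible point for the combination of y and z.
Surjectivity matters: it excludes an empty feasible set, whose `sInf` would be the default 0. -/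
lemma convexOn_valueFn (hL : Function.Surjective L) (hc : ConvexOn ℝ Set.univ c)
    (hc0 : ∀ x, 0 ≤ c x) : ConvexOn ℝ Set.univ (valueFn L c) := by
  refine ⟨convex_univ, fun y _ z _ a b ha hb hab => ?_⟩
  refine le_of_forall_pos_lt_add fun ε hε => ?_
  obtain ⟨x₁, rfl, h₁⟩ := exists_lt_of_valueFn_lt hL (lt_add_of_pos_right (valueFn L c y) hε)
  obtain ⟨x₂, rfl, h₂⟩ := exists_lt_of_valueFn_lt hL (lt_add_of_pos_right (valueFn L c z) hε)
  have h3 := hc.2 (Set.mem_univ x₁) (Set.mem_univ x₂) ha hb hab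
  have h4 := valueFn_le (L := L) hc0 (a • x₁ + b • x₂)
  rw [map_add, map_smul, map_smul] at h4
  simp only [smul_eq_mul] at *
  have h5 : a * c x₁ + b * c x₂ < a * (valueFn L c (L x₁) + ε) + b * (valueFn L c (L x₂) + ε) := by
    rcases ha.eq_or_lt with rfl | ha'
    · obtain rfl : b = 1 := by linarith
      linarith
    · have := mul_lt_mul_of_pos_left h₁ ha'
      have := mul_le_mul_of_nonneg_left h₂.le hb
      linarith
  have h6 : a * ε + b * ε = ε := by rw [← add_mul, hab, one_mul]
  linarith

lemma continuous_valueFn [FiniteDimensional ℝ F] (hL : Function.Surjective L) (hc : ConvexOn ℝ Set.univ c)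
    (hc0 : ∀ x, 0 ≤ c x) : Continuous (valueFn L c) :=
  continuousOn_univ.1 ((convexOn_valueFn hL hc hc0).continuousOn isOpen_univ)

/-- Strong duality: a Lagrange multiplier of a linearly constrained convex problem. -/
lemma exists_multiplier [FiniteDimensional ℝ F] (hL : Function.Surjective L) (hc : ConvexOn ℝ Set.univ c)
    (hc0 : ∀ x, 0 ≤ c x) (y : F) :
    ∃ η : F, ∀ x, valueFn L c y + inner ℝ η (L x - y) ≤ c x := by
  obtain ⟨η, hη⟩ := exists_subgradient (convexOn_valueFn hL hc hc0) y
  exact ⟨η, fun x => (hη (L x)).trans (valueFn_le hc0 x)⟩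

end Convex

/-- Bounded measurable vector fields on `ℝ^m` that vanish outside a ball. -/
def perturbations (m : ℕ) :
    Submodule ℝ (EuclideanSpace ℝ (Fin m) → EuclideanSpace ℝ (Fin m)) where
  carrier := {Δ | Measurable Δ ∧ ∃ R : ℝ, ∀ w, ‖Δ w‖ ≤ R ∧ (R < ‖w‖ → Δ w = 0)}
  add_mem' := by
    rintro Δ₁ Δ₂ ⟨hm₁, R₁, h₁⟩ ⟨hm₂, R₂, h₂⟩
    have hR₁ : 0 ≤ R₁ := (norm_nonneg _).trans (h₁ 0).1
    have hR₂ : 0 ≤ R₂ := (norm_nonneg _).trans (h₂ 0).1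
    -- The same number bounds both the size and the radius of the support, so it must dominate R₁
    -- and R₂ separately as well as their sum.
    refine ⟨hm₁.add hm₂, R₁ + R₂, fun w => ⟨?_, fun hw => ?_⟩⟩
    · exact (norm_add_le _ _).trans (add_le_add (h₁ w).1 (h₂ w).1)
    · simp [(h₁ w).2 (by linarith), (h₂ w).2 (by linarith)]
  zero_mem' := ⟨measurable_const, 0, by simp⟩
  smul_mem' := by
    rintro t Δ ⟨hm, R, h⟩
    have hR : 0 ≤ R := (norm_nonneg _).trans (h 0).1
    refine ⟨hm.const_smul t, (|t| + 1) * R, fun w => ⟨?_, fun hw => ?_⟩⟩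
    · rw [Pi.smul_apply, norm_smul, Real.norm_eq_abs]
      have := mul_le_mul_of_nonneg_left (h w).1 (abs_nonneg t)
      linarith
    · have := mul_nonneg (abs_nonneg t) hR
      rw [Pi.smul_apply, (h w).2 (by linarith), smul_zero]

/-! ### Perturbation fields, their cost and their first-order response -/

section Perturbation

variable {m r : ℕ}

lemma exists_ellNorm_perturbation_le (q : ℝ≥0∞) [Fact (1 ≤ q)] (Δ : perturbations m) :
    ∃ C : ℝ, ∀ w, ellNorm q (Δ.1 w).ofLp ≤ C := by
  obtain ⟨C, hC0, hC⟩ := exists_ellNorm_le q m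
  obtain ⟨-, R, hR⟩ := Δ.2
  exact ⟨C * R, fun w => (hC _).trans (by gcongr; exact (hR w).1)⟩

lemma measurable_ellNorm_perturbation (q : ℝ≥0∞) [Fact (1 ≤ q)] (Δ : perturbations m) :
    Measurable fun w => ellNorm q (Δ.1 w).ofLp := by
  have := (continuous_ellNorm (k := m) q).comp (PiLp.continuous_ofLp 2 fun _ : Fin m => ℝ)
  exact this.measurable.comp Δ.2.1

lemma exists_norm_fderiv_perturbation_le {g : EuclideanSpace ℝ (Fin m) → EuclideanSpace ℝ (Fin r)} (hg : ContDiff ℝ 1 g)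
    (Δ : perturbations m) : ∃ C : ℝ, ∀ w, ‖fderiv ℝ g w (Δ.1 w)‖ ≤ C := by
  obtain ⟨-, R, hR⟩ := Δ.2
  obtain ⟨C, hC⟩ := (isCompact_closedBall (0 : EuclideanSpace ℝ (Fin m)) R).exists_bound_of_continuousOn
    (hg.continuous_fderiv one_ne_zero).continuousOn
  have hR0 : 0 ≤ R := (norm_nonneg _).trans (hR 0).1
  have hC0 : 0 ≤ C := (norm_nonneg _).trans (hC 0 (by simpa))
  refine ⟨C * R, fun w => ?_⟩
  by_cases hw : R < ‖w‖
  · rw [(hR w).2 hw, map_zero, norm_zero]; positivity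
  · refine (ContinuousLinearMap.le_opNorm _ _).trans ?_
    gcongr
    · exact hC w (by simpa using hw)
    · exact (hR w).1

lemma measurable_fderiv_perturbation {g : EuclideanSpace ℝ (Fin m) → EuclideanSpace ℝ (Fin r)} (hg : ContDiff ℝ 1 g)
    (Δ : perturbations m) : Measurable fun w => fderiv ℝ g w (Δ.1 w) := by
  have h : Continuous fun z : EuclideanSpace ℝ (Fin m) × EuclideanSpace ℝ (Fin m) => fderiv ℝ g z.1 z.2 :=
    ((hg.continuous_fderiv one_ne_zero).comp continuous_fst).clm_apply continuous_snd
  exact h.measurable.comp (measurable_id.prodMk Δ.2.1)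

variable {Ω : Type*} [MeasurableSpace Ω] {μ : Measure Ω} {W : Ω → EuclideanSpace ℝ (Fin m)}

variable (μ W) in
/-- The cost `E‖Δ(W)‖_q ^ ρ` of the perturbation `Δ`. -/
def pertCost (q : ℝ≥0∞) (ρ : ℝ) (Δ : perturbations m) : ℝ :=
  ∫ ω, ellNorm q (Δ.1 (W ω)).ofLp ^ ρ ∂μ

lemma pertCost_nonneg (q : ℝ≥0∞) [Fact (1 ≤ q)] (ρ : ℝ) (Δ : perturbations m) :
    0 ≤ pertCost μ W q ρ Δ :=
  integral_nonneg fun _ => Real.rpow_nonneg (ellNorm_nonneg q _) _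

lemma pertCost_zero (q : ℝ≥0∞) [Fact (1 ≤ q)] {ρ : ℝ} (hρ : 1 ≤ ρ) :
    pertCost μ W q ρ 0 = 0 := by
  simp [pertCost, ellNorm_zero, Real.zero_rpow (by linarith : ρ ≠ 0)]

variable {g : EuclideanSpace ℝ (Fin m) → EuclideanSpace ℝ (Fin r)}

lemma rowNorm_jacobian_eq_zero (p q : ℝ≥0∞) [p.HolderConjugate q] {ζ : EuclideanSpace ℝ (Fin r)} {w : EuclideanSpace ℝ (Fin m)} (h : ∀ x, inner ℝ ζ (fderiv ℝ g w x) = 0) :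
    rowNorm p ζ (jacobian g w) = 0 := by
  obtain ⟨d, -, -, hd⟩ := exists_measurable_dual p q m
  have := h (WithLp.toLp 2 (d (Matrix.vecMul ζ.ofLp (jacobian g w))))
  rw [inner_fderiv_eq_sum] at this
  exact (hd _).symm.trans this

/-- The zero vector is a convex combination of values of `g`. -/
lemma zero_mem_convexHull_range (p q : ℝ≥0∞) [p.HolderConjugate q]
    (hg : ContDiff ℝ 1 g)
    (hint : Integrable (fun ω => g (W ω)) μ) (hmean : ∫ ω, g (W ω) ∂μ = 0)
    (hnondeg : ∀ ζ : EuclideanSpace ℝ (Fin r), ζ ≠ 0 → 0 < μ {ω | 0 < rowNorm p ζ (jacobian g (W ω))}) :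
    (0 : EuclideanSpace ℝ (Fin r)) ∈ convexHull ℝ (Set.range g) := by
  by_contra h0
  obtain ⟨ζ, hζ0, hζ⟩ := exists_inner_nonpos_of_notMem (convex_convexHull ℝ _)
    ⟨g 0, subset_convexHull ℝ (Set.range g) ⟨0, rfl⟩⟩ h0
  have hle : ∀ w, inner ℝ ζ (g w) ≤ 0 := fun w => hζ _ (subset_convexHull ℝ _ ⟨w, rfl⟩)
  -- A nonpositive function with mean zero vanishes almost surely. So almost every W is a global
  -- maximum of ζᵀg, where the gradient is zero, against non-degeneracy.
  have h1 : ∫ ω, -inner ℝ ζ (g (W ω)) ∂μ = 0 := by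
    rw [integral_neg, integral_inner hint, hmean, inner_zero_right, neg_zero]
  have h2 := (integral_eq_zero_iff_of_nonneg (fun ω => by simpa using hle (W ω))
    (hint.const_inner ζ).neg).1 h1
  refine (hnondeg ζ hζ0).ne' ?_
  have h3 : ∀ᵐ ω ∂μ, ¬ 0 < rowNorm p ζ (jacobian g (W ω)) := by
    filter_upwards [h2] with ω hω
    have hω' : inner ℝ ζ (g (W ω)) = 0 := by simpa using hω
    have hmax : IsLocalMax (fun w => inner ℝ ζ (g w)) (W ω) :=
      Eventually.of_forall fun w => by simpa [hω'] using hle w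
    have hd := (hg.differentiable one_ne_zero (W ω)).hasFDerivAt
    have hz := hmax.hasFDerivAt_eq_zero ((innerSL ℝ ζ).hasFDerivAt.comp (W ω) hd)
    rw [rowNorm_jacobian_eq_zero p q fun x => by simpa using DFunLike.congr_fun hz x]
    exact lt_irrefl _
  simpa [ae_iff] using h3

variable [IsProbabilityMeasure μ]

lemma integrable_ellNorm_rpow (hW : Measurable W) (q : ℝ≥0∞) [Fact (1 ≤ q)] {ρ : ℝ} (hρ : 1 ≤ ρ)
    (Δ : perturbations m) : Integrable (fun ω => ellNorm q (Δ.1 (W ω)).ofLp ^ ρ) μ := by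
  obtain ⟨C, hC⟩ := exists_ellNorm_perturbation_le q Δ
  refine Integrable.of_bound
    (((measurable_ellNorm_perturbation q Δ).comp hW).pow_const ρ).aestronglyMeasurable
    (C ^ ρ) (ae_of_all _ fun ω => ?_)
  have h0 := ellNorm_nonneg q (Δ.1 (W ω)).ofLp
  rw [Real.norm_of_nonneg (by positivity)]
  exact Real.rpow_le_rpow h0 (hC _) (by linarith)

lemma integrable_fderiv_perturbation (hW : Measurable W) (hg : ContDiff ℝ 1 g)
    (Δ : perturbations m) : Integrable (fun ω => fderiv ℝ g (W ω) (Δ.1 (W ω))) μ := by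
  obtain ⟨C, hC⟩ := exists_norm_fderiv_perturbation_le hg Δ
  exact Integrable.of_bound ((measurable_fderiv_perturbation hg Δ).comp hW).aestronglyMeasurable
    C (ae_of_all _ fun ω => hC _)

variable (μ) in
/-- The first-order response `E[Dg(W) Δ(W)]` of `E[g(W)]` to the perturbation `Δ`. -/
def response (hW : Measurable W) (hg : ContDiff ℝ 1 g) : perturbations m →ₗ[ℝ] EuclideanSpace ℝ (Fin r) where
  toFun Δ := ∫ ω, fderiv ℝ g (W ω) (Δ.1 (W ω)) ∂μ
  map_add' Δ₁ Δ₂ := by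
    rw [← integral_add (integrable_fderiv_perturbation hW hg Δ₁)
      (integrable_fderiv_perturbation hW hg Δ₂)]
    simp
  map_smul' t Δ := by
    simp [integral_smul]

lemma convexOn_pertCost (hW : Measurable W) (q : ℝ≥0∞) [Fact (1 ≤ q)] {ρ : ℝ} (hρ : 1 ≤ ρ) :
    ConvexOn ℝ Set.univ (pertCost μ W q ρ) := by
  refine ⟨convex_univ, fun Δ₁ _ Δ₂ _ a b ha hb hab => ?_⟩
  simp only [pertCost, smul_eq_mul]
  have h₁ := integrable_ellNorm_rpow (μ := μ) hW q hρ Δ₁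
  have h₂ := integrable_ellNorm_rpow (μ := μ) hW q hρ Δ₂
  rw [← integral_const_mul, ← integral_const_mul, ← integral_add (h₁.const_mul a) (h₂.const_mul b)]
  refine integral_mono (integrable_ellNorm_rpow hW q hρ _)
    ((h₁.const_mul a).add (h₂.const_mul b)) fun ω => ?_
  have e₁ := ellNorm_nonneg q (Δ₁.1 (W ω)).ofLp
  have e₂ := ellNorm_nonneg q (Δ₂.1 (W ω)).ofLp
  have h3 : ellNorm q ((a • Δ₁ + b • Δ₂ : perturbations m).1 (W ω)).ofLp ≤
      a * ellNorm q (Δ₁.1 (W ω)).ofLp + b * ellNorm q (Δ₂.1 (W ω)).ofLp := by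
    have := ellNorm_add_le q (a • (Δ₁.1 (W ω)).ofLp) (b • (Δ₂.1 (W ω)).ofLp)
    rwa [ellNorm_smul, ellNorm_smul, abs_of_nonneg ha, abs_of_nonneg hb] at this
  exact (Real.rpow_le_rpow (ellNorm_nonneg q _) h3 (by linarith)).trans
    ((convexOn_rpow hρ).2 e₁ e₂ ha hb hab)

lemma inner_response (hW : Measurable W) (hg : ContDiff ℝ 1 g) (ζ : EuclideanSpace ℝ (Fin r))
    (Δ : perturbations m) : inner ℝ ζ (response μ hW hg Δ) =
      ∫ ω, inner ℝ ζ (fderiv ℝ g (W ω) (Δ.1 (W ω))) ∂μ :=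
  (integral_inner (integrable_fderiv_perturbation hW hg Δ) ζ).symm

lemma rowNorm_nonneg (p : ℝ≥0∞) [Fact (1 ≤ p)] (ζ : EuclideanSpace ℝ (Fin r)) (A : Matrix (Fin r) (Fin m) ℝ) :
    0 ≤ rowNorm p ζ A := ellNorm_nonneg p _

/-- Perturbations of prescribed length in the direction in which `ζᵀ g` increases fastest. -/
lemma exists_extremal_perturbation (p q : ℝ≥0∞) [p.HolderConjugate q]
    (hg : ContDiff ℝ 1 g) (ζ : EuclideanSpace ℝ (Fin r)) {t : EuclideanSpace ℝ (Fin m) → ℝ} (ht : Measurable t)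
    (ht0 : ∀ w, 0 ≤ t w) (N T : ℝ) (hT : ∀ w, ‖w‖ ≤ N → t w ≤ T) :
    ∃ Δ : perturbations m, ∀ w,
      ellNorm q (Δ.1 w).ofLp ≤ (Metric.closedBall 0 N).indicator t w ∧
      inner ℝ ζ (fderiv ℝ g w (Δ.1 w)) =
        (Metric.closedBall 0 N).indicator t w * rowNorm p ζ (jacobian g w) := by
  have : Fact (1 ≤ q) := ⟨ENNReal.HolderConjugate.one_le q p⟩
  obtain ⟨d, hdm, hd1, hd⟩ := exists_measurable_dual p q m
  obtain ⟨C, hC0, hC⟩ := exists_norm_le_ellNorm q m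
  set τ := (Metric.closedBall (0 : EuclideanSpace ℝ (Fin m)) N).indicator t with hτ
  have hτ0 : ∀ w, 0 ≤ τ w := fun w => Set.indicator_nonneg (fun w _ => ht0 w) w
  have hτT : ∀ w, τ w ≤ |T| := fun w => by
    by_cases hw : w ∈ Metric.closedBall (0 : EuclideanSpace ℝ (Fin m)) N
    · rw [hτ, Set.indicator_of_mem hw]
      exact (hT w (by simpa using hw)).trans (le_abs_self _)
    · rw [hτ, Set.indicator_of_notMem hw]; positivity
  let Δ : EuclideanSpace ℝ (Fin m) → EuclideanSpace ℝ (Fin m) := fun w => τ w • WithLp.toLp 2 (d (Matrix.vecMul ζ.ofLp (jacobian g w)))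
  have hΔ : Δ ∈ perturbations m := by
    refine ⟨?_, |T| * C + |N|, fun w => ⟨?_, fun hw => ?_⟩⟩
    · exact (ht.indicator Metric.isClosed_closedBall.measurableSet).smul
        ((PiLp.continuous_toLp 2 _).measurable.comp
          (hdm.comp (continuous_vecMul_jacobian hg ζ).measurable))
    · rw [norm_smul, Real.norm_of_nonneg (hτ0 w)]
      have h1 := (hC (WithLp.toLp 2 (d (Matrix.vecMul ζ.ofLp (jacobian g w))))).trans
        (mul_le_of_le_one_right hC0 (hd1 _))
      have := mul_le_mul (hτT w) h1 (norm_nonneg _) (abs_nonneg T)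
      linarith [abs_nonneg N]
    · have : w ∉ Metric.closedBall (0 : EuclideanSpace ℝ (Fin m)) N := by
        rw [mem_closedBall_zero_iff, not_le]
        linarith [le_abs_self N, mul_nonneg (abs_nonneg T) hC0]
      simp [Δ, hτ, Set.indicator_of_notMem this]
  refine ⟨⟨Δ, hΔ⟩, fun w => ⟨?_, ?_⟩⟩
  · change ellNorm q (τ w • d (Matrix.vecMul ζ.ofLp (jacobian g w))) ≤ τ w
    rw [ellNorm_smul, abs_of_nonneg (hτ0 w)]
    exact mul_le_of_le_one_right (hτ0 w) (hd1 _)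
  · simp only [Δ]
    rw [map_smul, inner_smul_right, inner_fderiv_eq_sum]
    exact congrArg _ (hd _)

/-- If ζ is orthogonal to the range, testing against the unit-length field of steepest ascent of ζᵀg
on a ball of radius n gives ∫ ‖ζᵀDg(W)‖_p = 0 over that ball. Letting n grow contradicts
non-degeneracy. -/
lemma response_surjective (p q : ℝ≥0∞) [p.HolderConjugate q]
    (hW : Measurable W) (hg : ContDiff ℝ 1 g)
    (hnondeg : ∀ ζ : EuclideanSpace ℝ (Fin r), ζ ≠ 0 → 0 < μ {ω | 0 < rowNorm p ζ (jacobian g (W ω))}) :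
    Function.Surjective (response μ hW hg) := by
  have : Fact (1 ≤ p) := ⟨ENNReal.HolderConjugate.one_le p q⟩
  rw [← LinearMap.range_eq_top]
  by_contra hne
  rw [← Submodule.orthogonal_eq_bot_iff] at hne
  obtain ⟨ζ, hζ, hζ0⟩ := Submodule.exists_mem_ne_zero_of_ne_bot hne
  have key : ∀ n : ℕ, ∀ᵐ ω ∂μ, ‖W ω‖ ≤ n → rowNorm p ζ (jacobian g (W ω)) = 0 := by
    intro n
    obtain ⟨Δ, hΔ⟩ := exists_extremal_perturbation p q hg ζ (t := fun _ => 1) measurable_const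
      (by simp) n 1 (by simp)
    have h0 : inner ℝ ζ (response μ hW hg Δ) = 0 :=
      (Submodule.mem_orthogonal' _ _).1 hζ _ ⟨Δ, rfl⟩
    rw [inner_response] at h0
    have hnn : ∀ ω, 0 ≤ inner ℝ ζ (fderiv ℝ g (W ω) (Δ.1 (W ω))) := fun ω => by
      rw [(hΔ _).2]
      exact mul_nonneg (Set.indicator_nonneg (by simp) _) (rowNorm_nonneg p _ _)
    have h1 := (integral_eq_zero_iff_of_nonneg hnn
      ((integrable_fderiv_perturbation hW hg Δ).const_inner ζ)).1 h0
    filter_upwards [h1] with ω hω hn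
    rw [(hΔ _).2, Set.indicator_of_mem (by simpa using hn)] at hω
    simpa using hω
  refine (hnondeg ζ hζ0).ne' ?_
  have h2 : ∀ᵐ ω ∂μ, ¬ 0 < rowNorm p ζ (jacobian g (W ω)) := by
    filter_upwards [ae_all_iff.2 key] with ω hω
    obtain ⟨n, hn⟩ := exists_nat_ge ‖W ω‖
    rw [hω n hn]; exact lt_irrefl _
  simpa [ae_iff] using h2

end Perturbation

lemma coe_sub_coe_ennreal_le {a c : ℝ} {J : ℝ≥0∞} (h : J ≠ ∞ → a - c ≤ J.toReal) :
    (a : EReal) - (J : EReal) ≤ c := by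
  by_cases hJ : J = ∞
  · simp [hJ]
  · have := h hJ
    rw [← EReal.coe_ennreal_toReal hJ, ← EReal.coe_sub, EReal.coe_le_coe_iff]
    linarith

lemma le_coe_sub_coe_ennreal {a c : ℝ} {J : ℝ≥0∞} (hc : c ≤ a) (h : J ≤ ENNReal.ofReal (a - c)) :
    (c : EReal) ≤ (a : EReal) - (J : EReal) := by
  have hJ : J ≠ ∞ := ne_top_of_le_ne_top ENNReal.ofReal_ne_top h
  have h2 := (ENNReal.le_ofReal_iff_toReal_le hJ (by linarith)).1 h
  rw [← EReal.coe_ennreal_toReal hJ, ← EReal.coe_sub, EReal.coe_le_coe_iff]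
  linarith

/-! ### Lagrangian duality between the perturbation problem and R̄ -/

section Duality

variable {m r : ℕ} {Ω : Type*} [MeasurableSpace Ω] {μ : Measure Ω} [IsProbabilityMeasure μ]
  {W : Ω → EuclideanSpace ℝ (Fin m)} {g : EuclideanSpace ℝ (Fin m) → EuclideanSpace ℝ (Fin r)}

/-- Weak duality for `ρ > 1`. -/
lemma objective_response_le (p q : ℝ≥0∞) [p.HolderConjugate q] {ρ : ℝ} (hρ : 1 < ρ)
    (hW : Measurable W) (hg : ContDiff ℝ 1 g) (ζ : EuclideanSpace ℝ (Fin r))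
    (Δ : perturbations m) :
    objective μ p ρ (fun ω => jacobian g (W ω)) (response μ hW hg Δ) ζ ≤
      (pertCost μ W q ρ Δ : EReal) := by
  have : Fact (1 ≤ p) := ⟨ENNReal.HolderConjugate.one_le p q⟩
  have : Fact (1 ≤ q) := ⟨ENNReal.HolderConjugate.one_le q p⟩
  have hc : ρ.HolderConjugate (ρ / (ρ - 1)) := Real.HolderConjugate.conjExponent hρ
  refine coe_sub_coe_ennreal_le fun hJ => ?_
  have hρ1 : 0 < ρ - 1 := by linarith
  have hI : ∫⁻ ω, ENNReal.ofReal (rowNorm p ζ (jacobian g (W ω)) ^ (ρ / (ρ - 1))) ∂μ ≠ ∞ := by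
    intro h
    rw [h, ENNReal.mul_top (by simpa using hρ)] at hJ
    exact hJ rfl
  have hN0 : ∀ ω, 0 ≤ rowNorm p ζ (jacobian g (W ω)) ^ (ρ / (ρ - 1)) := fun ω =>
    Real.rpow_nonneg (rowNorm_nonneg p _ _) _
  have hmeas : Measurable fun ω => rowNorm p ζ (jacobian g (W ω)) ^ (ρ / (ρ - 1)) :=
    ((continuous_rowNorm_jacobian p hg ζ).measurable.comp hW).pow_const _
  have hint : Integrable (fun ω => rowNorm p ζ (jacobian g (W ω)) ^ (ρ / (ρ - 1))) μ := by
    refine ⟨hmeas.aestronglyMeasurable, ?_⟩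
    rw [hasFiniteIntegral_iff_ofReal (ae_of_all _ hN0)]
    exact lt_top_iff_ne_top.2 hI
  rw [ENNReal.toReal_mul, ENNReal.toReal_ofReal hρ1.le,
    ← integral_eq_lintegral_of_nonneg_ae (ae_of_all _ hN0) hmeas.aestronglyMeasurable,
    inner_response, sub_le_iff_le_add, pertCost, ← integral_const_mul, ← integral_const_mul,
    ← integral_add (hint.const_mul _) (integrable_ellNorm_rpow hW q hρ.le Δ)]
  refine integral_mono (((integrable_fderiv_perturbation hW hg Δ).const_inner ζ).const_mul ρ)
    ((hint.const_mul _).add (integrable_ellNorm_rpow hW q hρ.le Δ)) fun ω => ?_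
  have h1 := inner_fderiv_le (g := g) p q (W ω) (Δ.1 (W ω)) ζ
  -- Hölder followed by Young: with s = ρ/(ρ-1) one has ρ/s = ρ - 1, so ρab ≤ a^ρ + (ρ-1)b^s, the
  -- source of the constants in the objective.
  have h2 := Real.young_inequality_of_nonneg (ellNorm_nonneg q (Δ.1 (W ω)).ofLp)
    (rowNorm_nonneg p ζ (jacobian g (W ω))) hc
  have h3 := mul_le_mul_of_nonneg_left
    ((h1.trans_eq (mul_comm _ _)).trans h2) (by linarith : 0 ≤ ρ)
  refine h3.trans_eq ?_
  have : ρ ≠ 0 := by linarith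
  field_simp
  ring

/-- Weak duality for `ρ = 1`. -/
lemma inner_response_le (p q : ℝ≥0∞) [p.HolderConjugate q]
    (hW : Measurable W) (hg : ContDiff ℝ 1 g) {ζ : EuclideanSpace ℝ (Fin r)}
    (hζ : ζ ∈ admissible μ p (fun ω => jacobian g (W ω))) (Δ : perturbations m) :
    inner ℝ ζ (response μ hW hg Δ) ≤ pertCost μ W q 1 Δ := by
  have : Fact (1 ≤ p) := ⟨ENNReal.HolderConjugate.one_le p q⟩
  have : Fact (1 ≤ q) := ⟨ENNReal.HolderConjugate.one_le q p⟩
  have hζ' : ∀ᵐ ω ∂μ, ¬ 1 < rowNorm p ζ (jacobian g (W ω)) := by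
    simpa [ae_iff] using show μ {ω | _} = 0 from hζ
  rw [inner_response, pertCost]
  refine integral_mono_ae ((integrable_fderiv_perturbation hW hg Δ).const_inner ζ)
    (integrable_ellNorm_rpow hW q le_rfl Δ) ?_
  filter_upwards [hζ'] with ω hω
  rw [Real.rpow_one]
  exact (inner_fderiv_le (g := g) p q (W ω) (Δ.1 (W ω)) ζ).trans
    (mul_le_of_le_one_left (ellNorm_nonneg q _) (not_lt.1 hω))

/-- Strong duality for `ρ > 1`. -/
lemma exists_valueFn_le_objective (p q : ℝ≥0∞) [p.HolderConjugate q] {ρ : ℝ} (hρ : 1 < ρ)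
    (hW : Measurable W) (hg : ContDiff ℝ 1 g)
    (hL : Function.Surjective (response μ hW hg)) (x : EuclideanSpace ℝ (Fin r)) :
    ∃ ζ, (valueFn (response μ hW hg) (pertCost μ W q ρ) x : EReal) ≤
      objective μ p ρ (fun ω => jacobian g (W ω)) x ζ := by
  have : Fact (1 ≤ p) := ⟨ENNReal.HolderConjugate.one_le p q⟩
  have : Fact (1 ≤ q) := ⟨ENNReal.HolderConjugate.one_le q p⟩
  have hρ0 : ρ ≠ 0 := by linarith
  have hρ1 : 0 < ρ - 1 := by linarith
  obtain ⟨η, hη⟩ := exists_multiplier hL (convexOn_pertCost (μ := μ) hW q hρ.le) (pertCost_nonneg q ρ) x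
    (L := response μ hW hg)
  set v := valueFn (response μ hW hg) (pertCost μ W q ρ) x
  -- The objective carries ρ ζᵀx, so the multiplier of the constraint is ρζ.
  set ζ := ρ⁻¹ • η with hζ
  have hηζ : η = ρ • ζ := by rw [hζ, smul_inv_smul₀ hρ0]
  rw [hηζ] at hη
  simp only [inner_smul_left, conj_trivial, inner_sub_right] at hη
  set N : EuclideanSpace ℝ (Fin m) → ℝ := fun w => rowNorm p ζ (jacobian g w) with hN
  have hNc : Continuous N := continuous_rowNorm_jacobian p hg ζ
  have hN0 : ∀ w, 0 ≤ N w := fun w => rowNorm_nonneg p _ _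
  set s := ρ / (ρ - 1) with hs
  have hs0 : 0 ≤ s := by positivity
  have hvx : v ≤ ρ * inner ℝ ζ x := by
    have := hη 0
    rw [map_zero, inner_zero_right, pertCost_zero q hρ.le] at this
    linarith
  refine ⟨ζ, le_coe_sub_coe_ennreal hvx ?_⟩
  have hpow : Continuous fun w => N w ^ s := hNc.rpow_const fun _ => Or.inr hs0
  have key : ∀ n : ℕ, ENNReal.ofReal (ρ - 1) *
      ∫⁻ ω, ENNReal.ofReal ((Metric.closedBall 0 (n : ℝ)).indicator (fun w => N w ^ s) (W ω)) ∂μ ≤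
        ENNReal.ofReal (ρ * inner ℝ ζ x - v) := by
    intro n
    have hcont : Continuous fun w => N w ^ (1 / (ρ - 1)) :=
      hNc.rpow_const fun _ => Or.inr (by positivity)
    obtain ⟨T, hT⟩ := (isCompact_closedBall (0 : EuclideanSpace ℝ (Fin m)) n).exists_bound_of_continuousOn
      hcont.continuousOn
    -- The length N^{1/(ρ-1)} is the equality case of Young: both the gain ζᵀDgΔ and the bound on
    -- the cost become N^s. The multiplier inequality then reads (ρ-1) E[N^s; ‖W‖ ≤ n] ≤ ρ ζᵀx - v.
    -- Truncation to a ball keeps Δ admissible without any moment of Dg; monotone convergence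
    -- removes it.
    obtain ⟨Δ, hΔ⟩ := exists_extremal_perturbation p q hg ζ hcont.measurable
      (fun w => Real.rpow_nonneg (hN0 w) _) n T
      (fun w hw => (le_abs_self _).trans (hT w (by simpa using hw)))
    set I := (Metric.closedBall (0 : EuclideanSpace ℝ (Fin m)) (n : ℝ)).indicator
      (fun w => N w ^ s) with hI
    have hI0 : ∀ w, 0 ≤ I w := fun w =>
      Set.indicator_nonneg (fun w _ => Real.rpow_nonneg (hN0 w) _) w
    have hin : ∀ w, inner ℝ ζ (fderiv ℝ g w (Δ.1 w)) = I w := fun w => by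
      rw [(hΔ w).2]
      by_cases hw : w ∈ Metric.closedBall (0 : EuclideanSpace ℝ (Fin m)) (n : ℝ)
      · rw [hI, Set.indicator_of_mem hw, Set.indicator_of_mem hw]
        change N w ^ (1 / (ρ - 1)) * N w = N w ^ s
        rw [← Real.rpow_add_one' (hN0 w) (by positivity)]
        congr 1
        rw [hs]; field_simp; ring
      · rw [hI, Set.indicator_of_notMem hw, Set.indicator_of_notMem hw, zero_mul]
    have hco : ∀ w, ellNorm q (Δ.1 w).ofLp ^ ρ ≤ I w := fun w => by
      refine (Real.rpow_le_rpow (ellNorm_nonneg q _) (hΔ w).1 (by linarith)).trans_eq ?_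
      by_cases hw : w ∈ Metric.closedBall (0 : EuclideanSpace ℝ (Fin m)) (n : ℝ)
      · rw [hI, Set.indicator_of_mem hw, Set.indicator_of_mem hw, ← Real.rpow_mul (hN0 w)]
        congr 1
        rw [hs]; field_simp
      · rw [hI, Set.indicator_of_notMem hw, Set.indicator_of_notMem hw, Real.zero_rpow hρ0]
    have hint : Integrable (fun ω => I (W ω)) μ := by
      have := (integrable_fderiv_perturbation (μ := μ) hW hg Δ).const_inner (𝕜 := ℝ) ζ
      simpa only [hin] using this
    have h1 := hη Δ
    rw [inner_response] at h1
    simp only [hin] at h1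
    have h2 : pertCost μ W q ρ Δ ≤ ∫ ω, I (W ω) ∂μ :=
      integral_mono (integrable_ellNorm_rpow hW q hρ.le Δ) hint fun ω => hco _
    rw [← ofReal_integral_eq_lintegral_ofReal hint (ae_of_all _ fun ω => hI0 _),
      ← ENNReal.ofReal_mul hρ1.le]
    refine ENNReal.ofReal_le_ofReal ?_
    linarith
  have hmono : Monotone fun (n : ℕ) ω =>
      ENNReal.ofReal ((Metric.closedBall 0 (n : ℝ)).indicator (fun w => N w ^ s) (W ω)) := by
    intro a b hab ω
    refine ENNReal.ofReal_le_ofReal (Set.indicator_le_indicator_of_subset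
      (Metric.closedBall_subset_closedBall (by exact_mod_cast hab))
      (fun w => Real.rpow_nonneg (hN0 w) _) _)
  have hsup : ∀ ω, ⨆ n : ℕ, ENNReal.ofReal
      ((Metric.closedBall 0 (n : ℝ)).indicator (fun w => N w ^ s) (W ω)) =
        ENNReal.ofReal (N (W ω) ^ s) := by
    intro ω
    refine le_antisymm (iSup_le fun n => ENNReal.ofReal_le_ofReal
      (Set.indicator_le_self' (fun w _ => Real.rpow_nonneg (hN0 w) _) _)) ?_
    obtain ⟨n, hn⟩ := exists_nat_ge ‖W ω‖
    refine le_iSup_of_le n ?_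
    rw [Set.indicator_of_mem (by simpa using hn)]
  have hlim : ∫⁻ ω, ENNReal.ofReal (N (W ω) ^ s) ∂μ = ⨆ n : ℕ, ∫⁻ ω, ENNReal.ofReal
      ((Metric.closedBall 0 (n : ℝ)).indicator (fun w => N w ^ s) (W ω)) ∂μ := by
    rw [← lintegral_iSup (fun n => ?_) hmono]
    · simp only [hsup]
    · exact ((hpow.measurable.indicator Metric.isClosed_closedBall.measurableSet).comp hW).ennreal_ofReal
  change ENNReal.ofReal (ρ - 1) * ∫⁻ ω, ENNReal.ofReal (N (W ω) ^ s) ∂μ ≤ _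
  rw [hlim, ENNReal.mul_iSup]
  exact iSup_le key

/-- Strong duality for `ρ = 1`. -/
lemma exists_admissible_valueFn_le (p q : ℝ≥0∞) [p.HolderConjugate q]
    (hW : Measurable W) (hg : ContDiff ℝ 1 g)
    (hL : Function.Surjective (response μ hW hg)) (x : EuclideanSpace ℝ (Fin r)) :
    ∃ ζ ∈ admissible μ p (fun ω => jacobian g (W ω)),
      valueFn (response μ hW hg) (pertCost μ W q 1) x ≤ inner ℝ ζ x := by
  have : Fact (1 ≤ p) := ⟨ENNReal.HolderConjugate.one_le p q⟩
  have : Fact (1 ≤ q) := ⟨ENNReal.HolderConjugate.one_le q p⟩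
  obtain ⟨ζ, hη⟩ := exists_multiplier hL (convexOn_pertCost (μ := μ) hW q le_rfl) (pertCost_nonneg q 1) x
    (L := response μ hW hg)
  set v := valueFn (response μ hW hg) (pertCost μ W q 1) x
  simp only [inner_sub_right] at hη
  set N : EuclideanSpace ℝ (Fin m) → ℝ := fun w => rowNorm p ζ (jacobian g w) with hN
  have hNc : Continuous N := continuous_rowNorm_jacobian p hg ζ
  have hvx : v ≤ inner ℝ ζ x := by
    have := hη 0
    rw [map_zero, inner_zero_right, pertCost_zero q le_rfl] at this
    linarith
  refine ⟨ζ, ?_, hvx⟩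
  have key : ∀ n : ℕ, ∀ᵐ ω ∂μ, ‖W ω‖ ≤ n → N (W ω) ≤ 1 := by
    intro n
    have hS : MeasurableSet {w | 1 < N w} := (isOpen_lt continuous_const hNc).measurableSet
    -- Unit steps exactly where the constraint N ≤ 1 is violated: gain minus cost is at least N - 1
    -- there.
    obtain ⟨Δ, hΔ⟩ := exists_extremal_perturbation p q hg ζ (t := {w | 1 < N w}.indicator 1)
      (measurable_one.indicator hS) (fun w => Set.indicator_nonneg (by simp) w) n 1
      (fun w _ => Set.indicator_le_self' (by simp) w)
    set e : Ω → ℝ := fun ω =>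
      inner ℝ ζ (fderiv ℝ g (W ω) (Δ.1 (W ω))) - ellNorm q (Δ.1 (W ω)).ofLp ^ (1 : ℝ) with he
    have hi1 := (integrable_fderiv_perturbation (μ := μ) hW hg Δ).const_inner (𝕜 := ℝ) ζ
    have hi2 := integrable_ellNorm_rpow (μ := μ) hW q le_rfl Δ
    have hlow : ∀ ω, (Metric.closedBall 0 (n : ℝ)).indicator ({w | 1 < N w}.indicator 1) (W ω) *
        (N (W ω) - 1) ≤ e ω := fun ω => by
      have h1 := (hΔ (W ω)).1
      simp only [he, (hΔ (W ω)).2, Real.rpow_one]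
      rw [mul_sub, mul_one]
      linarith
    have hnn : ∀ ω, 0 ≤ (Metric.closedBall 0 (n : ℝ)).indicator
        ({w | 1 < N w}.indicator 1) (W ω) * (N (W ω) - 1) := fun ω => by
      by_cases h : 1 < N (W ω)
      · exact mul_nonneg (Set.indicator_nonneg
          (fun w _ => Set.indicator_nonneg (by simp) w) _) (by linarith)
      · classical
        rw [Set.indicator_apply, Set.indicator_of_notMem (by simpa using h)]
        simp
    have he0 : ∀ ω, 0 ≤ e ω := fun ω => (hnn ω).trans (hlow ω)
    -- For ρ = 1 gain and cost are both homogeneous of degree one in Δ. Scaling by arbitrarily large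
    -- a leaves the right side fixed and forces the net gain to vanish.
    have hbound : ∀ a : ℝ, 0 ≤ a → a * ∫ ω, e ω ∂μ ≤ inner ℝ ζ x - v := by
      intro a ha
      have h1 := hη (a • Δ)
      have h2 : pertCost μ W q 1 (a • Δ) = a * pertCost μ W q 1 Δ := by
        simp only [pertCost, Real.rpow_one]
        rw [← integral_const_mul]
        congr 1; ext ω
        have := ellNorm_smul q a (Δ.1 (W ω)).ofLp
        rwa [abs_of_nonneg ha] at this
      rw [h2, map_smul, inner_smul_right, inner_response] at h1
      rw [he, integral_sub hi1 hi2, mul_sub]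
      change _ - a * pertCost μ W q 1 Δ ≤ _
      linarith
    have hzero : ∫ ω, e ω ∂μ = 0 := by
      refine le_antisymm ?_ (integral_nonneg he0)
      by_contra! hpos
      have := hbound ((inner ℝ ζ x - v + 1) / ∫ ω, e ω ∂μ) (by
        have : 0 ≤ inner ℝ ζ x - v := by linarith
        positivity)
      rw [div_mul_cancel₀ _ hpos.ne'] at this
      linarith
    have hae := (integral_eq_zero_iff_of_nonneg he0 (hi1.sub hi2)).1 hzero
    filter_upwards [hae] with ω hω hn
    by_contra! h
    have h3 := hlow ω
    rw [hω, Set.indicator_of_mem (by simpa using hn), Set.indicator_of_mem (by simpa using h)] at h3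
    simp at h3
    linarith
  have h2 : ∀ᵐ ω ∂μ, ¬ 1 < N (W ω) := by
    filter_upwards [ae_all_iff.2 key] with ω hω
    obtain ⟨n, hn⟩ := exists_nat_ge ‖W ω‖
    exact not_lt.2 (hω n hn)
  change μ {ω | 1 < N (W ω)} = 0
  simpa [ae_iff] using h2

/-- Weak duality at near-optimal fields bounds every value of the objective; the multiplier attains
the bound. Feasible minimizers Δ need not exist. -/
lemma isGreatest_objective (p q : ℝ≥0∞) [p.HolderConjugate q] {ρ : ℝ} (hρ : 1 < ρ)
    (hW : Measurable W) (hg : ContDiff ℝ 1 g)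
    (hL : Function.Surjective (response μ hW hg)) (x : EuclideanSpace ℝ (Fin r)) :
    IsGreatest (Set.range (objective μ p ρ (fun ω => jacobian g (W ω)) x))
      (valueFn (response μ hW hg) (pertCost μ W q ρ) x : EReal) := by
  have : Fact (1 ≤ q) := ⟨ENNReal.HolderConjugate.one_le q p⟩
  have hub : ∀ ζ, objective μ p ρ (fun ω => jacobian g (W ω)) x ζ ≤
      (valueFn (response μ hW hg) (pertCost μ W q ρ) x : EReal) := by
    intro ζ
    refine EReal.le_of_forall_lt_iff_le.1 fun a ha => ?_
    obtain ⟨Δ, rfl, h⟩ := exists_lt_of_valueFn_lt hL (EReal.coe_lt_coe_iff.1 ha)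
    exact (objective_response_le p q hρ hW hg ζ Δ).trans (EReal.coe_le_coe_iff.2 h.le)
  obtain ⟨ζ, hζ⟩ := exists_valueFn_le_objective p q hρ hW hg hL x
  exact ⟨⟨ζ, le_antisymm (hub ζ) hζ⟩, by rintro _ ⟨ζ, rfl⟩; exact hub ζ⟩

lemma isGreatest_admissible (p q : ℝ≥0∞) [p.HolderConjugate q]
    (hW : Measurable W) (hg : ContDiff ℝ 1 g)
    (hL : Function.Surjective (response μ hW hg)) (x : EuclideanSpace ℝ (Fin r)) :
    IsGreatest ((fun ζ => inner ℝ ζ x) '' admissible μ p (fun ω => jacobian g (W ω)))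
      (valueFn (response μ hW hg) (pertCost μ W q 1) x) := by
  have : Fact (1 ≤ q) := ⟨ENNReal.HolderConjugate.one_le q p⟩
  have hub : ∀ ζ ∈ admissible μ p (fun ω => jacobian g (W ω)), inner ℝ ζ x ≤
      valueFn (response μ hW hg) (pertCost μ W q 1) x := fun ζ hζ =>
    le_valueFn hL fun Δ hΔ => hΔ ▸ inner_response_le p q hW hg hζ Δ
  obtain ⟨ζ, hζ, hle⟩ := exists_admissible_valueFn_le p q hW hg hL x
  exact ⟨⟨ζ, hζ, le_antisymm (hub ζ hζ) hle⟩, by rintro _ ⟨ζ, hζ, rfl⟩; exact hub ζ hζ⟩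

/-- This trades a maximum over ζ with possibly infinite penalties for a continuous function, which
supplies measurability of R̄ and the link with transport plans. -/
lemma rbar_eq_valueFn (p q : ℝ≥0∞) [p.HolderConjugate q] {ρ : ℝ} (hρ : 1 ≤ ρ)
    (hW : Measurable W) (hg : ContDiff ℝ 1 g)
    (hL : Function.Surjective (response μ hW hg)) :
    rbar μ p ρ (fun ω => jacobian g (W ω)) = valueFn (response μ hW hg) (pertCost μ W q ρ) := by
  ext x
  rw [rbar]
  split_ifs with h
  · subst h
    exact (isGreatest_admissible p q hW hg hL x).csSup_eq
  · have := (isGreatest_objective p q (lt_of_le_of_ne hρ (Ne.symm h)) hW hg hL x).csSup_eq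
    rw [sSup_range] at this
    rw [this, EReal.toReal_coe]

end Duality

/-! ### Transport plans to an empirical distribution -/

section Transport

variable {E F : Type*} [MeasurableSpace E] [NormedAddCommGroup F] [NormedSpace ℝ F]
  {c : E → E → ℝ≥0∞} {g : E → F} {x : ℕ → E} {n : ℕ}

lemma isProbabilityMeasure_average (hn : 0 < n) (P : ℕ → Measure E)
    (hP : ∀ i ∈ Finset.range n, IsProbabilityMeasure (P i)) :
    IsProbabilityMeasure ((n : ℝ≥0∞)⁻¹ • ∑ i ∈ Finset.range n, P i) := by
  constructor
  rw [Measure.smul_apply, Measure.finsetSum_apply,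
    Finset.sum_congr rfl fun i hi => (hP i hi).measure_univ]
  simp only [Finset.sum_const, Finset.card_range, nsmul_eq_mul, mul_one, smul_eq_mul]
  exact ENNReal.inv_mul_cancel (by simpa using hn.ne') (ENNReal.natCast_ne_top n)

/-- Transporting every sample point `x_i` to a law `P_i` bounds the profile from above. -/
lemma profile_empirical_le (hc : Measurable (Function.uncurry c)) (hn : 0 < n)
    (P : ℕ → Measure E) (hP : ∀ i ∈ Finset.range n, IsProbabilityMeasure (P i))
    (hint : ∀ i ∈ Finset.range n, Integrable g (P i))
    (hzero : ∑ i ∈ Finset.range n, ∫ w, g w ∂P i = 0) :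
    profile c g (empirical x n) ≤
      (n : ℝ≥0∞)⁻¹ * ∑ i ∈ Finset.range n, ∫⁻ u, c u (x i) ∂P i := by
  set π : Measure (E × E) :=
    (n : ℝ≥0∞)⁻¹ • ∑ i ∈ Finset.range n, (P i).map (fun u => (u, x i)) with hπ
  have hn' : (n : ℝ≥0∞)⁻¹ ≠ ∞ := by simpa using hn.ne'
  have hmap : ∀ i, Measurable fun u : E => (u, x i) := fun i => measurable_id.prodMk measurable_const
  have hprob : ∀ i ∈ Finset.range n, IsProbabilityMeasure ((P i).map (fun u => (u, x i))) :=
    fun i hi => by have := hP i hi; exact Measure.isProbabilityMeasure_map (hmap i).aemeasurable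
  have hfst : π.map Prod.fst = (n : ℝ≥0∞)⁻¹ • ∑ i ∈ Finset.range n, P i := by
    rw [hπ, Measure.map_smul, ← Measure.mapₗ_apply_of_measurable measurable_fst, map_sum]
    congr 1
    refine Finset.sum_congr rfl fun i _ => ?_
    rw [Measure.mapₗ_apply_of_measurable measurable_fst, Measure.map_map measurable_fst (hmap i)]
    exact Measure.map_id
  have hsnd : π.map Prod.snd = empirical x n := by
    rw [hπ, Measure.map_smul, ← Measure.mapₗ_apply_of_measurable measurable_snd, map_sum, empirical]
    congr 1
    refine Finset.sum_congr rfl fun i hi => ?_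
    have := hP i hi
    rw [Measure.mapₗ_apply_of_measurable measurable_snd, Measure.map_map measurable_snd (hmap i)]
    change Measure.map (fun _ => x i) (P i) = _
    simp [Measure.map_const]
  have hint' : Integrable g ((n : ℝ≥0∞)⁻¹ • ∑ i ∈ Finset.range n, P i) :=
    (integrable_finsetSum_measure.2 hint).smul_measure hn'
  have hzero' : ∫ w, g w ∂((n : ℝ≥0∞)⁻¹ • ∑ i ∈ Finset.range n, P i) = 0 := by
    rw [integral_smul_measure, integral_finsetSum_measure hint, hzero, smul_zero]
  refine (iInf₂_le _ (isProbabilityMeasure_average hn P hP)).trans ?_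
  refine (iInf₂_le hint' hzero').trans ?_
  refine (iInf₂_le π (isProbabilityMeasure_average hn _ hprob)).trans ?_
  refine (iInf₂_le hfst hsnd).trans_eq ?_
  rw [hπ, lintegral_smul_measure, lintegral_finsetSum_measure, smul_eq_mul]
  congr 1
  exact Finset.sum_congr rfl fun i _ => lintegral_map hc (hmap i)

/-- The profile of an empirical distribution as an infimum over families of laws. -/
lemma profile_empirical_eq [StandardBorelSpace E]
    (hc : Measurable (Function.uncurry c)) (hn : 0 < n) :
    profile c g (empirical x n) =
      ⨅ (P : ℕ → Measure E) (_ : (∀ i ∈ Finset.range n, IsProbabilityMeasure (P i)) ∧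
          (∀ i ∈ Finset.range n, Integrable g (P i)) ∧ ∑ i ∈ Finset.range n, ∫ w, g w ∂P i = 0),
        (n : ℝ≥0∞)⁻¹ * ∑ i ∈ Finset.range n, ∫⁻ u, c u (x i) ∂P i := by
  refine le_antisymm (le_iInf₂ fun P hP => profile_empirical_le hc hn P hP.1 hP.2.1 hP.2.2) ?_
  refine le_iInf fun Q => le_iInf fun hQ => le_iInf fun hQi => le_iInf fun hQ0 =>
    le_iInf fun π => le_iInf fun hπ => le_iInf fun hfst => le_iInf fun hsnd => ?_
  have : Nonempty E := ⟨x 0⟩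
  have hn0 : (n : ℝ≥0∞)⁻¹ ≠ 0 := ENNReal.inv_ne_zero.2 (ENNReal.natCast_ne_top n)
  have hn' : (n : ℝ≥0∞)⁻¹ ≠ ∞ := by simpa using hn.ne'
  -- Plans have the sample as second marginal, while disintegration conditions on the first. After
  -- the swap, the conditional law at x_i serves as the law P_i to which x_i is sent.
  set π' := π.map Prod.swap with hπ'
  have : IsProbabilityMeasure π' := Measure.isProbabilityMeasure_map measurable_swap.aemeasurable
  have hfst' : π'.fst = empirical x n := by
    rw [Measure.fst, hπ', Measure.map_map measurable_fst measurable_swap, ← hsnd]; rfl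
  have hsnd' : π'.snd = Q := by
    rw [Measure.snd, hπ', Measure.map_map measurable_snd measurable_swap, ← hfst]; rfl
  set κ := π'.condKernel with hκ
  have hdis : (empirical x n) ⊗ₘ κ = π' := by
    rw [← hfst']; exact π'.disintegrate π'.condKernel
  have hlin : ∀ f : E → ℝ≥0∞, Measurable f →
      ∫⁻ w, f w ∂(empirical x n) = (n : ℝ≥0∞)⁻¹ * ∑ i ∈ Finset.range n, f (x i) := by
    intro f hf
    rw [empirical, lintegral_smul_measure, lintegral_finsetSum_measure, smul_eq_mul]
    simp only [lintegral_dirac' _ hf]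
  have : SFinite (empirical x n) := by rw [← hfst']; infer_instance
  have hQκ : Q = (n : ℝ≥0∞)⁻¹ • ∑ i ∈ Finset.range n, κ (x i) := by
    ext s hs
    rw [← hsnd', ← hdis, Measure.snd_compProd, Measure.bind_apply hs κ.aemeasurable,
      hlin _ (κ.measurable_coe hs)]
    simp
  have hint : ∀ i ∈ Finset.range n, Integrable g (κ (x i)) := by
    rw [hQκ, integrable_smul_measure hn0 hn'] at hQi
    exact integrable_finsetSum_measure.1 hQi
  refine (iInf₂_le (fun i => κ (x i)) ⟨fun i _ => inferInstance, hint, ?_⟩).trans_eq ?_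
  · have hsw : Measurable fun z : E × E => c z.2 z.1 := hc.comp measurable_swap
    have h1 : ∫⁻ z, c z.1 z.2 ∂π = ∫⁻ z, c z.2 z.1 ∂π' := by
      rw [hπ', lintegral_map hsw measurable_swap]; rfl
    rw [h1, ← hdis, Measure.lintegral_compProd hsw,
      hlin _ (Measurable.lintegral_kernel_prod_right' hsw)]
  · rw [hQκ, integral_smul_measure, integral_finsetSum_measure hint] at hQ0
    refine (smul_eq_zero.1 hQ0).resolve_left ?_
    exact ENNReal.toReal_ne_zero.2 ⟨hn0, hn'⟩

/-- The profile is bounded by the cost of a transport to a mixture of finitely many samples. -/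
lemma profile_empirical_le_of_mixture [CompleteSpace F] [MeasurableSingletonClass E]
    (hc : Measurable (Function.uncurry c)) (hn : 0 < n)
    {ι : Type*} [Fintype ι] {a : ι → ℝ} (ha : ∀ k, 0 ≤ a k) (hsum : ∑ k, a k = 1)
    (u : ι → ℕ → E) (hzero : ∑ i ∈ Finset.range n, ∑ k, a k • g (u k i) = 0) :
    profile c g (empirical x n) ≤
      (n : ℝ≥0∞)⁻¹ * ∑ i ∈ Finset.range n, ∑ k, ENNReal.ofReal (a k) * c (u k i) (x i) := by
  have hint : ∀ i, ∀ k ∈ Finset.univ,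
      Integrable g (ENNReal.ofReal (a k) • Measure.dirac (u k i)) := fun i k _ =>
    (integrable_dirac (by simp)).smul_measure ENNReal.ofReal_ne_top
  refine (profile_empirical_le (g := g) hc hn
    (fun i => ∑ k, ENNReal.ofReal (a k) • Measure.dirac (u k i)) (fun i _ => ⟨?_⟩)
    (fun i _ => integrable_finsetSum_measure.2 (hint i)) ?_).trans_eq ?_
  · simp [← ENNReal.ofReal_sum_of_nonneg fun k _ => ha k, hsum]
  · rw [← hzero]
    refine Finset.sum_congr rfl fun i _ => ?_
    rw [integral_finsetSum_measure (hint i)]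
    simp [integral_smul_measure, ENNReal.toReal_ofReal, ha]
  · simp

end Transport

/-! ### Semicontinuity, measurability and finiteness of the profile -/

section Profile

variable {m : ℕ}

lemma continuous_normCost_real (q : ℝ≥0∞) [Fact (1 ≤ q)] :
    Continuous fun z : EuclideanSpace ℝ (Fin m) × EuclideanSpace ℝ (Fin m) =>
      ellNorm q (z.1 - z.2).ofLp :=
  (continuous_ellNorm q).comp ((PiLp.continuous_ofLp 2 _).comp (continuous_fst.sub continuous_snd))

lemma continuous_normCost (q : ℝ≥0∞) [Fact (1 ≤ q)] {ρ : ℝ} (hρ : 1 ≤ ρ) :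
    Continuous (Function.uncurry (normCost (m := m) q ρ)) :=
  ENNReal.continuous_ofReal.comp
    ((continuous_normCost_real q).rpow_const fun _ => Or.inr (by linarith))

lemma normCost_le (q : ℝ≥0∞) [Fact (1 ≤ q)] {ρ : ℝ} (hρ : 1 ≤ ρ)
    (u w w₀ : EuclideanSpace ℝ (Fin m)) :
    normCost q ρ u w ≤ 2 ^ (ρ - 1) * (normCost q ρ u w₀ + normCost q ρ w₀ w) := by
  have h : ellNorm q (u - w).ofLp ≤ ellNorm q (u - w₀).ofLp + ellNorm q (w₀ - w).ofLp := by
    simpa using ellNorm_add_le q (u - w₀).ofLp (w₀ - w).ofLp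
  have hρ0 : 0 ≤ ρ := by linarith
  simp only [normCost, ← ENNReal.ofReal_rpow_of_nonneg (ellNorm_nonneg q _) hρ0]
  refine le_trans ?_ (ENNReal.rpow_add_le_mul_rpow_add_rpow _ _ hρ)
  refine ENNReal.rpow_le_rpow ?_ hρ0
  rw [← ENNReal.ofReal_add (ellNorm_nonneg q _) (ellNorm_nonneg q _)]
  exact ENNReal.ofReal_le_ofReal h

/-- Where the integral is infinite there is nothing to prove. Where it is finite, the quasi-triangle
inequality `normCost_le` gives a local dominating function. -/
lemma upperSemicontinuous_lintegral_normCost (q : ℝ≥0∞) [Fact (1 ≤ q)] {ρ : ℝ} (hρ : 1 ≤ ρ)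
    (P : Measure (EuclideanSpace ℝ (Fin m))) [IsProbabilityMeasure P] :
    UpperSemicontinuous fun w => ∫⁻ u, normCost q ρ u w ∂P := by
  intro w₀
  by_cases htop : ∫⁻ u, normCost q ρ u w₀ ∂P = ∞
  · intro a ha
    simp [htop] at ha
  have hcont := continuous_normCost (m := m) q hρ
  refine ContinuousAt.upperSemicontinuousAt ?_
  refine tendsto_lintegral_filter_of_dominated_convergence
    (fun u => 2 ^ (ρ - 1) * (normCost q ρ u w₀ + 1)) ?_ ?_ ?_ ?_
  · exact Eventually.of_forall fun w =>
      (hcont.comp (continuous_id.prodMk continuous_const)).measurable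
  · have h0 : ∀ᶠ w in nhds w₀, normCost q ρ w₀ w < 1 := by
      have h1 : ContinuousAt (fun w => normCost q ρ w₀ w) w₀ :=
        (hcont.comp (continuous_const.prodMk continuous_id)).continuousAt
      refine h1.eventually_lt continuousAt_const ?_
      simp [normCost, ellNorm_zero, Real.zero_rpow (by linarith : ρ ≠ 0)]
    filter_upwards [h0] with w hw
    refine ae_of_all _ fun u => (normCost_le q hρ u w w₀).trans ?_
    gcongr
  · rw [lintegral_const_mul' _ _ (ENNReal.rpow_ne_top_of_nonneg (by linarith) (by simp)),
      lintegral_add_right _ measurable_const]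
    refine ENNReal.mul_ne_top (ENNReal.rpow_ne_top_of_nonneg (by linarith) (by simp)) ?_
    simp [htop]
  · exact ae_of_all _ fun u =>
      ((hcont.comp (continuous_const.prodMk continuous_id)).tendsto w₀)

variable {F : Type*} [NormedAddCommGroup F] [NormedSpace ℝ F]

/-- The infimum runs over uncountably many families of laws, so measurability cannot be read off
directly. The feasible families do not depend on the sample, and infima of arbitrary families
preserve upper semicontinuity. -/
lemma upperSemicontinuous_profile_empirical (q : ℝ≥0∞) [Fact (1 ≤ q)] {ρ : ℝ} (hρ : 1 ≤ ρ)
    (g : EuclideanSpace ℝ (Fin m) → F) {n : ℕ} (hn : 0 < n) :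
    UpperSemicontinuous fun x : ℕ → EuclideanSpace ℝ (Fin m) =>
      profile (normCost q ρ) g (empirical x n) := by
  simp only [profile_empirical_eq (continuous_normCost q hρ).measurable hn]
  refine upperSemicontinuous_iInf fun P => upperSemicontinuous_iInf fun hP => ?_
  have hsum : UpperSemicontinuous fun x : ℕ → EuclideanSpace ℝ (Fin m) =>
      ∑ i ∈ Finset.range n, ∫⁻ u, normCost q ρ u (x i) ∂P i :=
    upperSemicontinuous_sum fun i hi => by
      have := hP.1 i hi
      exact UpperSemicontinuous.comp (g := fun x : ℕ → EuclideanSpace ℝ (Fin m) => x i)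
        (upperSemicontinuous_lintegral_normCost q hρ (P i))
        (continuous_apply i)
  exact (ENNReal.continuous_const_mul (by simpa using hn.ne')).comp_upperSemicontinuous hsum
    fun a b hab => by dsimp only; gcongr

lemma measurable_profile_empirical (q : ℝ≥0∞) [Fact (1 ≤ q)] {ρ : ℝ} (hρ : 1 ≤ ρ)
    (g : EuclideanSpace ℝ (Fin m) → F) (n : ℕ) :
    Measurable fun x : ℕ → EuclideanSpace ℝ (Fin m) =>
      profile (normCost q ρ) g (empirical x n) := by
  rcases Nat.eq_zero_or_pos n with rfl | hn
  -- For n = 0 the empty sum gives the zero measure, so the profile is constant in the sample.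
  · have : ∀ x : ℕ → EuclideanSpace ℝ (Fin m), empirical x 0 = 0 := fun x => by simp [empirical]
    simp only [this]
    exact measurable_const
  · exact (upperSemicontinuous_profile_empirical q hρ g hn).measurable

/-- Send every sample point to one fixed finitely supported law with g-mean zero; its cost is
finite. -/
lemma profile_empirical_ne_top [CompleteSpace F] (q : ℝ≥0∞) [Fact (1 ≤ q)] {ρ : ℝ} (hρ : 1 ≤ ρ)
    {g : EuclideanSpace ℝ (Fin m) → F} (h0 : (0 : F) ∈ convexHull ℝ (Set.range g))
    (x : ℕ → EuclideanSpace ℝ (Fin m)) {n : ℕ} (hn : 0 < n) :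
    profile (normCost q ρ) g (empirical x n) ≠ ∞ := by
  obtain ⟨ι, _, a, z, ha, hsum, hz, h⟩ := mem_convexHull_iff_exists_fintype.1 h0
  choose u hu using hz
  refine ne_top_of_le_ne_top ?_ (profile_empirical_le_of_mixture (g := g)
    (continuous_normCost q hρ).measurable hn ha hsum (fun k _ => u k) (by simp [hu, h]))
  refine ENNReal.mul_ne_top (by simpa using hn.ne') ?_
  exact ENNReal.sum_ne_top.2 fun i _ => ENNReal.sum_ne_top.2 fun k _ =>
    ENNReal.mul_ne_top ENNReal.ofReal_ne_top ENNReal.ofReal_ne_top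

end Profile

/-! ### The multivariate central limit theorem -/

section CentralLimit

open BoundedContinuousFunction

variable {r : ℕ} {Ω Ω' : Type*} [MeasurableSpace Ω] [MeasurableSpace Ω']
  {μ : Measure Ω} {ν : Measure Ω'} [IsProbabilityMeasure ν]
  {V : Ω → EuclideanSpace ℝ (Fin r)}

lemma memLp_apply (hV : MemLp V 2 μ) (i : Fin r) : MemLp (fun ω => V ω i) 2 μ :=
  hV.continuousLinearMap_comp (EuclideanSpace.proj i : EuclideanSpace ℝ (Fin r) →L[ℝ] ℝ)

lemma charFun_map_eq_charFun_map_inner_one {S : Ω → EuclideanSpace ℝ (Fin r)}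
    (hS : AEMeasurable S μ) (t : EuclideanSpace ℝ (Fin r)) :
    charFun (μ.map S) t = charFun (μ.map fun ω => inner ℝ (S ω) t) 1 := by
  have h : AEMeasurable (fun ω => inner ℝ (S ω) t) μ := by fun_prop
  rw [charFun_apply, charFun_apply, integral_map hS (by fun_prop), integral_map h (by fun_prop)]
  simp

variable [IsProbabilityMeasure μ]

lemma covMat_apply_of_integral_eq_zero (hV : MemLp V 2 μ) (h0 : ∫ ω, V ω ∂μ = 0) (i j : Fin r) :
    covMat μ V i j = ∫ ω, V ω i * V ω j ∂μ := by
  have hz : ∀ i, ∫ ω, V ω i ∂μ = 0 := fun i => by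
    have := (EuclideanSpace.proj i : EuclideanSpace ℝ (Fin r) →L[ℝ] ℝ).integral_comp_comm
      (hV.integrable one_le_two)
    rw [h0] at this
    simpa using this
  rw [covMat, Matrix.of_apply, covariance_eq_sub (memLp_apply hV i) (memLp_apply hV j), hz i]
  simp

lemma dotProduct_covMat_mulVec (hV : MemLp V 2 μ) (t : Fin r → ℝ) :
    t ⬝ᵥ (covMat μ V).mulVec t = Var[fun ω => ∑ i, t i * V ω i; μ] := by
  rw [variance_fun_sum fun i => (memLp_apply hV i).const_mul (t i)]
  simp only [dotProduct, Matrix.mulVec, covMat, Matrix.of_apply, Finset.mul_sum,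
    covariance_const_mul_left, covariance_const_mul_right]
  refine Finset.sum_congr rfl fun i _ => Finset.sum_congr rfl fun j _ => ?_
  ring

lemma posSemidef_covMat (hV : MemLp V 2 μ) : (covMat μ V).PosSemidef := by
  refine Matrix.PosSemidef.of_dotProduct_mulVec_nonneg ?_ fun t => ?_
  · ext i j
    simp [covMat, covariance_comm]
  · rw [star_trivial, dotProduct_covMat_mulVec hV]
    exact variance_nonneg _ _

/-- The multivariate central limit theorem. -/
theorem tendsto_integral_inv_sqrt_smul_sum {Y : ℕ → Ω → EuclideanSpace ℝ (Fin r)}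
    (hindep : iIndepFun Y μ) (hident : ∀ i, IdentDistrib (Y i) V μ μ)
    (hV : MemLp V 2 μ) (h0 : ∫ ω, V ω ∂μ = 0)
    {H : Ω' → EuclideanSpace ℝ (Fin r)} (hH : HasLaw H (multivariateGaussian 0 (covMat μ V)) ν)
    (φ : EuclideanSpace ℝ (Fin r) →ᵇ ℝ) :
    Tendsto (fun n : ℕ => ∫ ω, φ ((√n)⁻¹ • ∑ i ∈ Finset.range n, Y i ω) ∂μ) atTop
      (nhds (∫ ω, φ (H ω) ∂ν)) := by
  have hYm : ∀ i, AEMeasurable (Y i) μ := fun i => (hident i).aemeasurable_fst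
  set S : ℕ → Ω → EuclideanSpace ℝ (Fin r) :=
    fun n ω => (√n)⁻¹ • ∑ i ∈ Finset.range n, Y i ω with hS
  have hSm : ∀ n, AEMeasurable (S n) μ := fun n =>
    (Finset.aemeasurable_fun_sum (Finset.range n) fun i _ => hYm i).const_smul (√n)⁻¹
  let M : ℕ → ProbabilityMeasure (EuclideanSpace ℝ (Fin r)) :=
    fun n => ⟨μ.map (S n), Measure.isProbabilityMeasure_map (hSm n)⟩
  let M₀ : ProbabilityMeasure (EuclideanSpace ℝ (Fin r)) :=
    ⟨multivariateGaussian 0 (covMat μ V), by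
      rw [← hH.map_eq]; exact Measure.isProbabilityMeasure_map hH.aemeasurable⟩
  have hM : Tendsto M atTop (nhds M₀) := by
    -- Cramér–Wold: the characteristic function at t is that of the projection onto t, evaluated at
    -- 1, which reduces to the scalar theorem.
    refine ProbabilityMeasure.tendsto_iff_tendsto_charFun.2 fun t => ?_
    change Tendsto (fun n => charFun (μ.map (S n)) t) atTop
      (nhds (charFun (multivariateGaussian 0 (covMat μ V)) t))
    set Z : ℕ → Ω → ℝ := fun i ω => inner ℝ (Y i ω) t with hZ
    have him : Measurable fun y : EuclideanSpace ℝ (Fin r) => inner ℝ y t := by fun_prop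
    have hZi : iIndepFun Z μ := hindep.comp (fun _ y => inner ℝ y t) fun _ => him
    have hZid : ∀ i, IdentDistrib (Z i) (fun ω => inner ℝ (V ω) t) μ μ :=
      fun i => (hident i).comp him
    have hZid0 : ∀ i, IdentDistrib (Z i) (Z 0) μ μ := fun i => (hZid i).trans (hZid 0).symm
    have hVt : MemLp (fun ω => inner ℝ (V ω) t) 2 μ := hV.inner_const t
    have hmean : ∫ ω, Z 0 ω ∂μ = 0 := by
      rw [(hZid 0).integral_eq]
      have := integral_inner (𝕜 := ℝ) (hV.integrable one_le_two) t
      rw [h0, inner_zero_right] at this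
      rw [← this]
      simp only [real_inner_comm]
    have hvar : Var[Z 0; μ] = t.ofLp ⬝ᵥ (covMat μ V).mulVec t.ofLp := by
      rw [(hZid 0).variance_eq, dotProduct_covMat_mulVec hV]
      simp [PiLp.inner_apply]
    have hclt := (tendstoInDistribution_inv_sqrt_mul_sum_sub (P := μ)
      (P' := gaussianReal 0 Var[Z 0; μ].toNNReal) (Y := id) (X := Z) HasLaw.id
      ((hZid 0).memLp_iff.2 hVt) hZi hZid0).tendsto
    have hlim := ProbabilityMeasure.tendsto_iff_tendsto_charFun.1 hclt 1
    simp only [ProbabilityMeasure.coe_mk, Measure.map_id, hmean, mul_zero, sub_zero] at hlim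
    rw [charFun_gaussianReal] at hlim
    rw [charFun_multivariateGaussian (posSemidef_covMat hV), ← hvar]
    convert hlim using 2
    · rename_i n
      rw [charFun_map_eq_charFun_map_inner_one (hSm n)]
      congr 2
      ext ω
      simp only [hS, hZ, inner_smul_left, sum_inner, conj_trivial]
    · simp [Real.coe_toNNReal _ (variance_nonneg _ _)]
  have := ProbabilityMeasure.tendsto_iff_forall_integral_tendsto.1 hM φ
  have e1 : ∀ n, ∫ x, φ x ∂(M n : Measure _) = ∫ ω, φ (S n ω) ∂μ := fun n =>
    integral_map (hSm n) φ.continuous.aestronglyMeasurable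
  have e2 : ∫ x, φ x ∂(M₀ : Measure _) = ∫ ω, φ (H ω) ∂ν := by
    change ∫ x, φ x ∂(multivariateGaussian 0 (covMat μ V)) = _
    rw [← hH.map_eq]
    exact integral_map hH.aemeasurable φ.continuous.aestronglyMeasurable
  simpa only [e1, e2] using this

end CentralLimit

/-! ### Perturbing the sample at scale n^{-1/2} -/

section Sample

variable {m r : ℕ} {g : EuclideanSpace ℝ (Fin m) → EuclideanSpace ℝ (Fin r)}

/-- The rescaled displacement `√n (g(w) - g(w - Δ(w) / √n))` of `g`. -/
def displacement (g : EuclideanSpace ℝ (Fin m) → EuclideanSpace ℝ (Fin r))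
    (Δ : perturbations m) (n : ℕ) (w : EuclideanSpace ℝ (Fin m)) : EuclideanSpace ℝ (Fin r) :=
  √n • (g w - g (w - (√n)⁻¹ • Δ.1 w))

/-- The displacement converges uniformly to the directional derivative. -/
lemma eventually_norm_displacement_sub_le (hg : ContDiff ℝ 1 g) (Δ : perturbations m)
    {ε : ℝ} (hε : 0 < ε) :
    ∀ᶠ n : ℕ in atTop, ∀ w, ‖displacement g Δ n w - fderiv ℝ g w (Δ.1 w)‖ ≤ ε := by
  obtain ⟨-, R, hR⟩ := Δ.2
  have hR0 : 0 ≤ R := (norm_nonneg _).trans (hR 0).1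
  have huc := (isCompact_closedBall (0 : EuclideanSpace ℝ (Fin m))
    (2 * R)).uniformContinuousOn_of_continuous (hg.continuous_fderiv one_ne_zero).continuousOn
  -- Moved points stay in the ball of radius 2R once n^{-1/2} < 1. The mean value inequality with
  -- modulus ε/(R+1) over a step of length at most n^{-1/2}R, rescaled by √n, gives εR/(R+1) ≤ ε.
  obtain ⟨δ, hδ, hcont⟩ := Metric.uniformContinuousOn_iff.1 huc (ε / (R + 1)) (by positivity)
  have hlim : Tendsto (fun n : ℕ => (√n)⁻¹ * R) atTop (nhds (0 * R)) :=
    (tendsto_inv_atTop_zero.comp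
      (Real.tendsto_sqrt_atTop.comp tendsto_natCast_atTop_atTop)).mul_const R
  have hlim' : Tendsto (fun n : ℕ => (√n)⁻¹) atTop (nhds 0) :=
    tendsto_inv_atTop_zero.comp (Real.tendsto_sqrt_atTop.comp tendsto_natCast_atTop_atTop)
  rw [zero_mul] at hlim
  filter_upwards [hlim.eventually_lt_const hδ, hlim'.eventually_lt_const one_pos,
    eventually_gt_atTop 0] with n hn1 hn2 hn3 w
  by_cases hw : R < ‖w‖
  · simp [displacement, (hR w).2 hw, hε.le]
  push Not at hw
  have hs : 0 < √(n : ℝ) := Real.sqrt_pos.2 (by exact_mod_cast hn3)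
  set t := (√(n : ℝ))⁻¹ with ht
  have ht0 : 0 < t := inv_pos.2 hs
  have htΔ : ‖t • Δ.1 w‖ ≤ t * R := by
    rw [norm_smul, Real.norm_of_nonneg ht0.le]
    gcongr
    exact (hR w).1
  have htR : t * R ≤ R := mul_le_of_le_one_left hR0 hn2.le
  have hwK : w ∈ Metric.closedBall (0 : EuclideanSpace ℝ (Fin m)) (2 * R) := by
    rw [mem_closedBall_zero_iff]; linarith
  have hC : Convex ℝ (Metric.closedBall (0 : EuclideanSpace ℝ (Fin m)) (2 * R) ∩ Metric.ball w δ) :=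
    (convex_closedBall _ _).inter (convex_ball _ _)
  have hmv := hC.norm_image_sub_le_of_norm_fderiv_le' (𝕜 := ℝ) (f := g) (φ := fderiv ℝ g w)
    (C := ε / (R + 1)) (x := w - t • Δ.1 w) (y := w)
    (fun z _ => hg.differentiable one_ne_zero z)
    (fun z hz => by
      rw [← dist_eq_norm]
      exact (hcont z hz.1 w hwK hz.2).le)
    ⟨by
      rw [mem_closedBall_zero_iff]
      have := norm_sub_le w (t • Δ.1 w)
      linarith, by
      rw [Metric.mem_ball, dist_self_sub_left]
      linarith⟩
    ⟨hwK, Metric.mem_ball_self hδ⟩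
  rw [sub_sub_cancel, map_smul] at hmv
  have hst : √(n : ℝ) * t = 1 := mul_inv_cancel₀ hs.ne'
  have heq : displacement g Δ n w - fderiv ℝ g w (Δ.1 w) =
      √(n : ℝ) • (g w - g (w - t • Δ.1 w) - t • fderiv ℝ g w (Δ.1 w)) := by
    rw [displacement, smul_sub (√(n : ℝ)) _ (t • _), smul_smul, hst, one_smul]
  rw [heq, norm_smul, Real.norm_of_nonneg hs.le]
  calc √(n : ℝ) * ‖g w - g (w - t • Δ.1 w) - t • fderiv ℝ g w (Δ.1 w)‖
      ≤ √(n : ℝ) * (ε / (R + 1) * (t * R)) := by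
        gcongr
        exact hmv.trans (by gcongr)
    _ = (√(n : ℝ) * t) * (ε * (R / (R + 1))) := by ring
    _ ≤ ε := by
        rw [hst, one_mul]
        exact mul_le_of_le_one_right hε.le ((div_le_one (by positivity)).2 (by linarith))

/-- A mixture of perturbed samples that satisfies the estimating equation bounds the profile. -/
lemma rpow_mul_profile_le (q : ℝ≥0∞) [Fact (1 ≤ q)] {ρ : ℝ} (hρ : 1 ≤ ρ)
    {x : ℕ → EuclideanSpace ℝ (Fin m)} {n : ℕ} (hn : 0 < n)
    {ι : Type*} [Fintype ι] {a : ι → ℝ} (ha : ∀ k, 0 ≤ a k) (hsum : ∑ k, a k = 1)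
    (Δ : ι → perturbations m)
    (h : ∑ k, a k • (n : ℝ)⁻¹ • ∑ i ∈ Finset.range n, displacement g (Δ k) n (x i) =
      (√n)⁻¹ • ∑ i ∈ Finset.range n, g (x i)) :
    (n : ℝ) ^ (ρ / 2) * (profile (normCost q ρ) g (empirical x n)).toReal ≤
      ∑ k, a k * ((n : ℝ)⁻¹ • ∑ i ∈ Finset.range n, ellNorm q ((Δ k).1 (x i)).ofLp ^ ρ) := by
  have hn0 : (0 : ℝ) < n := by exact_mod_cast hn
  have hs : 0 < √(n : ℝ) := Real.sqrt_pos.2 hn0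
  have hss : √(n : ℝ) * √(n : ℝ) = n := Real.mul_self_sqrt hn0.le
  set t := (√(n : ℝ))⁻¹ with ht
  have ht0 : 0 < t := inv_pos.2 hs
  have hst : √(n : ℝ) * t = 1 := mul_inv_cancel₀ hs.ne'
  have hts : t * √(n : ℝ) = 1 := inv_mul_cancel₀ hs.ne'
  have hg : ∀ k i, g (x i - t • (Δ k).1 (x i)) = g (x i) - t • displacement g (Δ k) n (x i) :=
    fun k i => by rw [displacement, smul_smul, hts, one_smul]; abel
  -- The hypothesis says that the mixed average displacement equals the rescaled sum of g(x_i),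
  -- which is exactly the estimating equation for the mixture: no Taylor remainder is left.
  have hzero : ∑ i ∈ Finset.range n, ∑ k, a k • g (x i - t • (Δ k).1 (x i)) = 0 := by
    have h1 : ∀ i, ∑ k, a k • g (x i - t • (Δ k).1 (x i)) =
        g (x i) - ∑ k, a k • t • displacement g (Δ k) n (x i) := fun i => by
      simp only [hg, smul_sub, Finset.sum_sub_distrib, ← Finset.sum_smul, hsum, one_smul]
    have h2 : ∑ i ∈ Finset.range n, ∑ k, a k • t • displacement g (Δ k) n (x i) =
        √(n : ℝ) • ∑ k, a k • (n : ℝ)⁻¹ • ∑ i ∈ Finset.range n, displacement g (Δ k) n (x i) := by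
      rw [Finset.sum_comm, Finset.smul_sum]
      refine Finset.sum_congr rfl fun k _ => ?_
      rw [← Finset.smul_sum, ← Finset.smul_sum, smul_comm (√(n : ℝ)), smul_smul (√(n : ℝ))]
      congr 2
      have : (n : ℝ)⁻¹ = t * t := by rw [ht, ← mul_inv, hss]
      rw [this, ← mul_assoc, hst, one_mul]
    simp only [h1]
    rw [Finset.sum_sub_distrib, h2, h, smul_smul, hst, one_smul, sub_self]
  have hle := profile_empirical_le_of_mixture (g := g) (x := x)
    (continuous_normCost q hρ).measurable hn ha hsum (fun k i => x i - t • (Δ k).1 (x i)) hzero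
  have he0 : ∀ k i, 0 ≤ ellNorm q ((Δ k).1 (x i)).ofLp ^ ρ := fun k i =>
    Real.rpow_nonneg (ellNorm_nonneg q _) _
  have hcost : ∀ k i, normCost q ρ (x i - t • (Δ k).1 (x i)) (x i) =
      ENNReal.ofReal (t ^ ρ * ellNorm q ((Δ k).1 (x i)).ofLp ^ ρ) := fun k i => by
    have h1 : (x i - t • (Δ k).1 (x i) - x i).ofLp = (-t) • ((Δ k).1 (x i)).ofLp := by
      rw [sub_sub_cancel_left, ← neg_smul]; rfl
    rw [normCost, h1, ellNorm_smul, abs_neg, abs_of_pos ht0,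
      Real.mul_rpow ht0.le (ellNorm_nonneg q _)]
  have hval : (n : ℝ≥0∞)⁻¹ * ∑ i ∈ Finset.range n, ∑ k, ENNReal.ofReal (a k) *
      normCost q ρ (x i - t • (Δ k).1 (x i)) (x i) = ENNReal.ofReal ((n : ℝ)⁻¹ *
        ∑ i ∈ Finset.range n, ∑ k, a k * (t ^ ρ * ellNorm q ((Δ k).1 (x i)).ofLp ^ ρ)) := by
    have hp : ∀ k i, 0 ≤ a k * (t ^ ρ * ellNorm q ((Δ k).1 (x i)).ofLp ^ ρ) := fun k i =>
      mul_nonneg (ha k) (mul_nonneg (by positivity) (he0 k i))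
    rw [ENNReal.ofReal_mul (by positivity), ENNReal.ofReal_inv_of_pos hn0, ENNReal.ofReal_natCast,
      ENNReal.ofReal_sum_of_nonneg fun i _ => Finset.sum_nonneg fun k _ => hp k i]
    congr 1
    refine Finset.sum_congr rfl fun i _ => ?_
    rw [ENNReal.ofReal_sum_of_nonneg fun k _ => hp k i]
    refine Finset.sum_congr rfl fun k _ => ?_
    rw [hcost, ENNReal.ofReal_mul (ha k)]
  rw [hval] at hle
  have hle' := ENNReal.toReal_le_of_le_ofReal (mul_nonneg (by positivity)
    (Finset.sum_nonneg fun i _ => Finset.sum_nonneg fun k _ =>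
      mul_nonneg (ha k) (mul_nonneg (by positivity) (he0 k i)))) hle
  refine (mul_le_mul_of_nonneg_left hle' (by positivity)).trans_eq ?_
  have hpow : (n : ℝ) ^ (ρ / 2) * t ^ ρ = 1 := by
    rw [ht, Real.inv_rpow hs.le, Real.sqrt_eq_rpow, ← Real.rpow_mul hn0.le,
      show 1 / 2 * ρ = ρ / 2 by ring]
    exact mul_inv_cancel₀ (by positivity)
  rw [Finset.sum_comm, Finset.mul_sum, Finset.mul_sum]
  refine Finset.sum_congr rfl fun k _ => ?_
  rw [← Finset.mul_sum, ← Finset.mul_sum, smul_eq_mul]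
  linear_combination (a k * (n : ℝ)⁻¹ * ∑ i ∈ Finset.range n, ellNorm q ((Δ k).1 (x i)).ofLp ^ ρ) * hpow

end Sample

/-! ### Almost sure local bounds -/

section Asymptotic

variable {m r : ℕ} {Ω : Type*} [MeasurableSpace Ω] {μ : Measure Ω}
  {W : Ω → EuclideanSpace ℝ (Fin m)} {X : ℕ → Ω → EuclideanSpace ℝ (Fin m)}
  {g : EuclideanSpace ℝ (Fin m) → EuclideanSpace ℝ (Fin r)}

/-- The strong law of large numbers for functions of the sample. -/
lemma ae_tendsto_average {G : Type*} [NormedAddCommGroup G] [NormedSpace ℝ G] [CompleteSpace G]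
    [MeasurableSpace G] [BorelSpace G] (hindep : iIndepFun X μ)
    (hident : ∀ i, IdentDistrib (X i) W μ μ) {f : EuclideanSpace ℝ (Fin m) → G}
    (hf : Measurable f) (hint : Integrable (fun ω => f (W ω)) μ) :
    ∀ᵐ ω ∂μ, Tendsto (fun n : ℕ => (n : ℝ)⁻¹ • ∑ i ∈ Finset.range n, f (X i ω)) atTop
      (nhds (∫ ω, f (W ω) ∂μ)) := by
  have hid : ∀ i, IdentDistrib (fun ω => f (X i ω)) (fun ω => f (W ω)) μ μ :=
    fun i => (hident i).comp hf
  have := strong_law_ae (fun i ω => f (X i ω)) ((hid 0).integrable_iff.2 hint)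
    (fun i j hij => (hindep.indepFun hij).comp hf hf) (fun i => (hid i).trans (hid 0).symm)
  rwa [(hid 0).integral_eq] at this

variable [IsProbabilityMeasure μ]

/-- The displacement changes with n, so the strong law does not apply to it directly; it applies to
the directional derivative, from which the displacement differs uniformly by a vanishing amount. -/
lemma ae_tendsto_average_displacement (hindep : iIndepFun X μ)
    (hident : ∀ i, IdentDistrib (X i) W μ μ) (hW : Measurable W) (hg : ContDiff ℝ 1 g)
    (Δ : perturbations m) :
    ∀ᵐ ω ∂μ, Tendsto (fun n : ℕ => (n : ℝ)⁻¹ • ∑ i ∈ Finset.range n, displacement g Δ n (X i ω))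
      atTop (nhds (response μ hW hg Δ)) := by
  filter_upwards [ae_tendsto_average hindep hident (measurable_fderiv_perturbation hg Δ)
    (integrable_fderiv_perturbation hW hg Δ)] with ω hω
  refine tendsto_of_tendsto_of_dist hω ?_
  rw [Metric.tendsto_atTop']
  intro ε hε
  obtain ⟨N, hN⟩ := eventually_atTop.1
    (eventually_norm_displacement_sub_le hg Δ (half_pos hε))
  refine ⟨N, fun n hn => ?_⟩
  rw [Real.dist_0_eq_abs, abs_of_nonneg dist_nonneg, dist_comm, dist_eq_norm, ← smul_sub,
    ← Finset.sum_sub_distrib, norm_smul, norm_inv, Real.norm_natCast]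
  have hn0 : (0 : ℝ) < n := by exact_mod_cast (Nat.zero_le N).trans_lt hn
  have h1 : ‖∑ i ∈ Finset.range n,
      (displacement g Δ n (X i ω) - fderiv ℝ g (X i ω) (Δ.1 (X i ω)))‖ ≤ n * (ε / 2) := by
    refine (norm_sum_le_of_le _ fun i _ => hN n hn.le (X i ω)).trans_eq ?_
    simp
  calc (n : ℝ)⁻¹ * _ ≤ (n : ℝ)⁻¹ * (n * (ε / 2)) := by gcongr
    _ = ε / 2 := by field_simp
    _ < ε := half_lt_self hε

lemma ae_tendsto_average_ellNorm_rpow (q : ℝ≥0∞) [Fact (1 ≤ q)] {ρ : ℝ} (hρ : 1 ≤ ρ)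
    (hindep : iIndepFun X μ) (hident : ∀ i, IdentDistrib (X i) W μ μ) (hW : Measurable W)
    (Δ : perturbations m) :
    ∀ᵐ ω ∂μ, Tendsto (fun n : ℕ => (n : ℝ)⁻¹ • ∑ i ∈ Finset.range n,
      ellNorm q (Δ.1 (X i ω)).ofLp ^ ρ) atTop (nhds (pertCost μ W q ρ Δ)) :=
  ae_tendsto_average (f := fun w => ellNorm q (Δ.1 w).ofLp ^ ρ) hindep hident
    ((measurable_ellNorm_perturbation q Δ).pow_const ρ) (integrable_ellNorm_rpow hW q hρ Δ)

/-- Near a fixed value of the rescaled sample mean, the rescaled profile is asymptotically bounded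
by the value function. -/
lemma exists_nhds_ae_eventually_le (q : ℝ≥0∞) [Fact (1 ≤ q)] {ρ : ℝ} (hρ : 1 ≤ ρ)
    (hindep : iIndepFun X μ) (hident : ∀ i, IdentDistrib (X i) W μ μ) (hW : Measurable W)
    (hg : ContDiff ℝ 1 g) (hL : Function.Surjective (response μ hW hg))
    {ε : ℝ} (hε : 0 < ε) (y : EuclideanSpace ℝ (Fin r)) :
    ∃ U ∈ nhds y, ∀ᵐ ω ∂μ, ∀ᶠ n : ℕ in atTop,
      (√n)⁻¹ • ∑ i ∈ Finset.range n, g (X i ω) ∈ U →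
      (n : ℝ) ^ (ρ / 2) * (profile (normCost q ρ) g (empirical (fun i => X i ω) n)).toReal ≤
        valueFn (response μ hW hg) (pertCost μ W q ρ)
          ((√n)⁻¹ • ∑ i ∈ Finset.range n, g (X i ω)) + ε := by
  set v := valueFn (response μ hW hg) (pertCost μ W q ρ) with hv
  have hvc : Continuous v :=
    continuous_valueFn hL (convexOn_pertCost hW q hρ) (pertCost_nonneg q ρ)
  have hε4 : 0 < ε / 4 := by positivity
  -- Continuity of v lets a small simplex around y fit in the sublevel set of v(y) + ε/4.
  -- Near-optimal fields add ε/4, the strict limit inequality absorbs the sampling error, and v(S_n)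
  -- > v(y) - ε/4 on the neighbourhood, so at most 3ε/4 is spent.
  obtain ⟨b, hyb, hbs⟩ := exists_mem_interior_convexHull_affineBasis
    (hvc.continuousAt.eventually_lt continuousAt_const (lt_add_of_pos_right (v y) hε4))
  have hbk : ∀ k, v (b k) < v y + ε / 4 := fun k =>
    hbs (subset_convexHull ℝ _ ⟨k, rfl⟩)
  have hex : ∀ k, ∃ Δ, response μ hW hg Δ = b k ∧ pertCost μ W q ρ Δ < v (b k) + ε / 4 :=
    fun k => exists_lt_of_valueFn_lt hL (lt_add_of_pos_right _ hε4)
  choose Δ hΔ hcost using hex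
  obtain ⟨δ, hδ, hball⟩ := exists_ball_subset_convexHull b hyb
  refine ⟨Metric.ball y δ ∩ {z | v y - ε / 4 < v z},
    inter_mem (Metric.ball_mem_nhds y hδ)
      (continuousAt_const.eventually_lt hvc.continuousAt (sub_lt_self _ hε4)), ?_⟩
  have hD : ∀ k, ∀ᵐ ω ∂μ, Tendsto (fun n : ℕ => (n : ℝ)⁻¹ • ∑ i ∈ Finset.range n,
      displacement g (Δ k) n (X i ω)) atTop (nhds (b k)) := fun k => by
    rw [← hΔ k]; exact ae_tendsto_average_displacement hindep hident hW hg (Δ k)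
  have hC := fun k => ae_tendsto_average_ellNorm_rpow q hρ hindep hident hW (Δ k)
  filter_upwards [ae_all_iff.2 hD, ae_all_iff.2 hC] with ω hωD hωC
  have e1 : ∀ᶠ n : ℕ in atTop, ∀ k, ‖(n : ℝ)⁻¹ • ∑ i ∈ Finset.range n,
      displacement g (Δ k) n (X i ω) - b k‖ ≤ δ := eventually_all.2 fun k => by
    filter_upwards [(Metric.tendsto_nhds.1 (hωD k)) δ hδ] with n hn
    rw [← dist_eq_norm]; exact hn.le
  have e2 : ∀ᶠ n : ℕ in atTop, ∀ k, (n : ℝ)⁻¹ • ∑ i ∈ Finset.range n,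
      ellNorm q ((Δ k).1 (X i ω)).ofLp ^ ρ < v y + ε / 4 + ε / 4 := eventually_all.2 fun k =>
    (hωC k).eventually_lt_const (by linarith [hcost k, hbk k])
  filter_upwards [e1, e2, eventually_gt_atTop 0] with n h1 h2 hn hU
  obtain ⟨ι, _, a, z, ha, hsum, hz, h⟩ :=
    mem_convexHull_iff_exists_fintype.1 (hball _ h1 hU.1)
  choose k hk using hz
  have := rpow_mul_profile_le q hρ (g := g) (x := fun i => X i ω) hn ha hsum (fun j => Δ (k j))
    (by rw [← h]; simp only [← hk])
  refine this.trans ?_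
  have hU2 : v y - ε / 4 < v _ := hU.2
  calc _ ≤ ∑ j, a j * (v y + ε / 4 + ε / 4) :=
        Finset.sum_le_sum fun j _ => mul_le_mul_of_nonneg_left (h2 (k j)).le (ha j)
    _ = v y + ε / 4 + ε / 4 := by rw [← Finset.sum_mul, hsum, one_mul]
    _ ≤ _ := by linarith

/-- The exceptional null set depends on the neighbourhood, so a finite subcover is what keeps the
union of null sets null. -/
lemma ae_eventually_le_of_isCompact (q : ℝ≥0∞) [Fact (1 ≤ q)] {ρ : ℝ} (hρ : 1 ≤ ρ)
    (hindep : iIndepFun X μ) (hident : ∀ i, IdentDistrib (X i) W μ μ) (hW : Measurable W)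
    (hg : ContDiff ℝ 1 g) (hL : Function.Surjective (response μ hW hg))
    {ε : ℝ} (hε : 0 < ε) {K : Set (EuclideanSpace ℝ (Fin r))} (hK : IsCompact K) :
    ∀ᵐ ω ∂μ, ∀ᶠ n : ℕ in atTop,
      (√n)⁻¹ • ∑ i ∈ Finset.range n, g (X i ω) ∈ K →
      (n : ℝ) ^ (ρ / 2) * (profile (normCost q ρ) g (empirical (fun i => X i ω) n)).toReal ≤
        valueFn (response μ hW hg) (pertCost μ W q ρ)
          ((√n)⁻¹ • ∑ i ∈ Finset.range n, g (X i ω)) + ε := by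
  refine hK.induction_on (p := fun K => ∀ᵐ ω ∂μ, ∀ᶠ n : ℕ in atTop,
      (√n)⁻¹ • ∑ i ∈ Finset.range n, g (X i ω) ∈ K →
      (n : ℝ) ^ (ρ / 2) * (profile (normCost q ρ) g (empirical (fun i => X i ω) n)).toReal ≤
        valueFn (response μ hW hg) (pertCost μ W q ρ)
          ((√n)⁻¹ • ∑ i ∈ Finset.range n, g (X i ω)) + ε) ?_ ?_ ?_ ?_
  · simp
  · intro s t hst h
    filter_upwards [h] with ω hω
    filter_upwards [hω] with n hn hs using hn (hst hs)
  · intro s t hs ht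
    filter_upwards [hs, ht] with ω hωs hωt
    filter_upwards [hωs, hωt] with n hns hnt h using h.elim hns hnt
  · intro y _
    obtain ⟨U, hU, h⟩ := exists_nhds_ae_eventually_le q hρ hindep hident hW hg hL hε y
    exact ⟨U, mem_nhdsWithin_of_mem_nhds hU, h⟩

end Asymptotic

/-! ### From almost sure bounds on compacts to the stochastic bound -/

section Limsup

open BoundedContinuousFunction

variable {F Ω Ω' : Type*} [NormedAddCommGroup F] [ProperSpace F]
  [MeasurableSpace F] [BorelSpace F] [MeasurableSpace Ω] [MeasurableSpace Ω']
  {μ : Measure Ω} [IsProbabilityMeasure μ] {ν : Measure Ω'} [IsProbabilityMeasure ν]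

/-- If `S_n` converges in distribution to `H` and `Y_n ≤ v(S_n) + ε` eventually while `S_n` stays in
a compact set, then `Y_n` is asymptotically stochastically bounded by `v(H)`. -/
lemma asympStochLE_of_eventually_le {Y : ℕ → Ω → ℝ} {S : ℕ → Ω → F} {H : Ω' → F} {v : F → ℝ}
    (hY : ∀ n, Measurable (Y n)) (hS : ∀ n, Measurable (S n)) (hH : AEMeasurable H ν)
    (hv : Continuous v)
    (hle : ∀ ε > 0, ∀ K : Set F, IsCompact K →
      ∀ᵐ ω ∂μ, ∀ᶠ n in atTop, S n ω ∈ K → Y n ω ≤ v (S n ω) + ε)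
    (hlim : ∀ φ : F →ᵇ ℝ, Tendsto (fun n => ∫ ω, φ (S n ω) ∂μ) atTop (nhds (∫ ω, φ (H ω) ∂ν))) :
    AsympStochLE μ ν Y (fun ω => v (H ω)) := by
  rintro f hf ⟨C, hC⟩ hmono
  have hC0 : 0 ≤ C := (abs_nonneg _).trans (hC 0)
  have hfl : ∀ t, -C ≤ f t := fun t => (abs_le.1 (hC t)).1
  have hfu : ∀ t, f t ≤ C := fun t => (abs_le.1 (hC t)).2
  set χ : ℕ → F → ℝ := fun k z => min 1 (max 0 (‖z‖ - k)) with hχ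
  have hχc : ∀ k, Continuous (χ k) := fun k => by simp only [hχ]; fun_prop
  have hχ0 : ∀ k z, 0 ≤ χ k z := fun k z => le_min zero_le_one (le_max_left _ _)
  have hχ1 : ∀ k z, χ k z ≤ 1 := fun k z => min_le_left _ _
  set ε : ℕ → ℝ := fun k => 1 / ((k : ℝ) + 1) with hε
  -- A bounded continuous majorant: χ vanishes on the ball of radius k and is 1 outside radius k +
  -- 1, where the penalty 2C exceeds any possible gap between values of f. Hence f(Y_n) ≤ G_k(S_n)
  -- eventually, whether or not S_n is in the compact ball.
  set G : ℕ → F → ℝ := fun k z => f (v z + ε k) + 2 * C * χ k z with hG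
  have hGc : ∀ k, Continuous (G k) := fun k =>
    (hf.comp (hv.add continuous_const)).add (continuous_const.mul (hχc k))
  have hGl : ∀ k z, -C ≤ G k z := fun k z => by
    have := mul_nonneg (mul_nonneg zero_le_two hC0) (hχ0 k z)
    have := hfl (v z + ε k)
    simp only [hG]; linarith
  have hGb : ∀ k z, ‖G k z‖ ≤ 3 * C := fun k z => by
    rw [Real.norm_eq_abs, abs_le]
    have := mul_le_of_le_one_right (mul_nonneg zero_le_two hC0) (hχ1 k z)
    have := hfu (v z + ε k)
    refine ⟨by linarith [hGl k z], ?_⟩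
    simp only [hG]; linarith
  have hbound : ∀ k, limsup (fun n => ∫ ω, f (Y n ω) ∂μ) atTop ≤ ∫ ω, G k (H ω) ∂ν := by
    intro k
    -- The index from which f(Y_n) ≤ G_k(S_n) holds depends on ω. The positive part of the excess is
    -- bounded and eventually zero almost surely, so its mean tends to 0 by dominated convergence.
    set e : ℕ → Ω → ℝ := fun n ω => max 0 (f (Y n ω) - G k (S n ω)) with he
    have hem : ∀ n, Measurable (e n) := fun n =>
      measurable_const.max ((hf.measurable.comp (hY n)).sub ((hGc k).measurable.comp (hS n)))
    have heb : ∀ n ω, ‖e n ω‖ ≤ 2 * C := fun n ω => by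
      rw [Real.norm_of_nonneg (le_max_left _ _)]
      exact max_le (by linarith) (by linarith [hfu (Y n ω), hGl k (S n ω)])
    have he0 : Tendsto (fun n => ∫ ω, e n ω ∂μ) atTop (nhds (∫ _, (0 : ℝ) ∂μ)) := by
      refine tendsto_integral_of_dominated_convergence (fun _ => 2 * C)
        (fun n => (hem n).aestronglyMeasurable) (integrable_const _)
        (fun n => ae_of_all _ (heb n)) ?_
      filter_upwards [hle (ε k) (by simp only [hε]; positivity) (Metric.closedBall 0 ((k : ℝ) + 1))
        (isCompact_closedBall _ _)] with ω hω
      refine tendsto_const_nhds.congr' ?_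
      filter_upwards [hω] with n hn
      refine (max_eq_left ?_).symm
      by_cases hK : S n ω ∈ Metric.closedBall (0 : F) ((k : ℝ) + 1)
      · have := hmono (hn hK)
        have := mul_nonneg (mul_nonneg zero_le_two hC0) (hχ0 k (S n ω))
        simp only [hG]; linarith
      · rw [mem_closedBall_zero_iff, not_le] at hK
        have : χ k (S n ω) = 1 := min_eq_left ((by linarith : (1 : ℝ) ≤ ‖S n ω‖ - k).trans
          (le_max_right _ _))
        simp only [hG, this]
        linarith [hfu (Y n ω), hfl (v (S n ω) + ε k)]
    have hGlim := hlim (BoundedContinuousFunction.ofNormedAddCommGroup (G k) (hGc k) _ (hGb k))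
    simp only [BoundedContinuousFunction.coe_ofNormedAddCommGroup] at hGlim
    have hsum := hGlim.add he0
    rw [integral_zero, add_zero] at hsum
    have hGi : ∀ n, Integrable (fun ω => G k (S n ω)) μ := fun n =>
      Integrable.of_bound ((hGc k).measurable.comp (hS n)).aestronglyMeasurable _
        (ae_of_all _ fun ω => hGb k _)
    have hei : ∀ n, Integrable (e n) μ := fun n =>
      Integrable.of_bound (hem n).aestronglyMeasurable _ (ae_of_all _ (heb n))
    have hfi : ∀ n, Integrable (fun ω => f (Y n ω)) μ := fun n =>
      Integrable.of_bound (hf.measurable.comp (hY n)).aestronglyMeasurable C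
        (ae_of_all _ fun ω => hC _)
    have hle' : ∀ n, ∫ ω, f (Y n ω) ∂μ ≤ ∫ ω, G k (S n ω) ∂μ + ∫ ω, e n ω ∂μ := fun n => by
      rw [← integral_add (hGi n) (hei n)]
      refine integral_mono (hfi n) ((hGi n).add (hei n)) fun ω => ?_
      have := le_max_right 0 (f (Y n ω) - G k (S n ω))
      simp only [he]; linarith
    rw [← hsum.limsup_eq]
    refine limsup_le_limsup (Eventually.of_forall hle') ?_ hsum.isBoundedUnder_le
    -- The real-valued `limsup` needs a lower bound on the sequence for monotonicity; f ≥ -C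
    -- supplies it.
    refine IsBoundedUnder.isCoboundedUnder_le ⟨-C, eventually_map.2 (Eventually.of_forall fun n => ?_)⟩
    have := integral_mono (integrable_const (-C)) (hfi n) fun ω => hfl (Y n ω)
    simpa using this
  have hGlim : Tendsto (fun k => ∫ ω, G k (H ω) ∂ν) atTop (nhds (∫ ω, f (v (H ω)) ∂ν)) := by
    refine tendsto_integral_of_dominated_convergence (fun _ => 3 * C)
      (fun k => ((hGc k).measurable.comp_aemeasurable hH).aestronglyMeasurable)
      (integrable_const _) (fun k => ae_of_all _ fun ω => hGb k _) (ae_of_all _ fun ω => ?_)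
    have h1 : Tendsto (fun k => f (v (H ω) + ε k)) atTop (nhds (f (v (H ω) + 0))) :=
      (hf.tendsto _).comp (tendsto_const_nhds.add tendsto_one_div_add_atTop_nhds_zero_nat)
    have h2 : Tendsto (fun k => 2 * C * χ k (H ω)) atTop (nhds 0) := by
      refine tendsto_const_nhds.congr' ?_
      obtain ⟨N, hN⟩ := exists_nat_ge ‖H ω‖
      filter_upwards [eventually_ge_atTop N] with k hk
      have : (N : ℝ) ≤ k := by exact_mod_cast hk
      simp only [hχ]
      rw [max_eq_left (by linarith), min_eq_right zero_le_one, mul_zero]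
    simpa using h1.add h2
  exact ge_of_tendsto' hGlim hbound

end Limsup

end RWP

end

/-! ### Assembly of the theorem -/

theorem mainTheorem1 {m l r : ℕ} {Ω Ω' : Type*} [MeasurableSpace Ω] [MeasurableSpace Ω']
    (μ : Measure Ω) [IsProbabilityMeasure μ] (ν : Measure Ω') [IsProbabilityMeasure ν]
    -- a random vector `W` and i.i.d. copies `X 0, X 1, …` of it
    (W : Ω → EuclideanSpace ℝ (Fin m)) (X : ℕ → Ω → EuclideanSpace ℝ (Fin m))
    (hW : Measurable W) (hX : ∀ i, Measurable (X i))
    (hindep : iIndepFun X μ) (hident : ∀ i, IdentDistrib (X i) W μ μ)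
    (h : EuclideanSpace ℝ (Fin m) → EuclideanSpace ℝ (Fin l) → EuclideanSpace ℝ (Fin r))
    (θ : EuclideanSpace ℝ (Fin l))
    -- the exponents of the cost `‖u - w‖_q ^ ρ`, and the conjugate exponent `p`
    (ρ : ℝ) (hρ : 1 ≤ ρ) (p q : ℝ≥0∞) (hq : 1 ≤ q) (hpq : 1 / p + 1 / q = 1)
    -- the estimating equation and the second moment
    (hmean : ∫ ω, h (W ω) θ ∂μ = 0) (hsq : Integrable (fun ω => ‖h (W ω) θ‖ ^ 2) μ)
    -- smoothness in `w`
    (hdiff : ContDiff ℝ 1 (fun w => h w θ))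
    -- non-degeneracy
    (hnondeg : ∀ ζ : EuclideanSpace ℝ (Fin r), ζ ≠ 0 →
      0 < μ {ω | 0 < RWP.rowNorm p ζ (RWP.jacobian (fun w => h w θ) (W ω))})
    -- the Gaussian vector `H ∼ N(0, Cov h(W, θ))`
    (H : Ω' → EuclideanSpace ℝ (Fin r))
    (hH : HasLaw H (multivariateGaussian 0 (RWP.covMat μ (fun ω => h (W ω) θ))) ν) :
    -- `R_n(θ; ρ)` is a finite random variable
    (∀ n, Measurable (fun ω => RWP.rwp q ρ h (fun i => X i ω) n θ)) ∧
    (∀ n, 0 < n → ∀ ω, RWP.rwp q ρ h (fun i => X i ω) n θ ≠ ∞) ∧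
    -- `R̄(ρ)` is a finite random variable, and its value is the stated maximum
    Measurable (RWP.rbar μ p ρ (fun ω => RWP.jacobian (fun w => h w θ) (W ω))) ∧
    (1 < ρ → ∀ x, IsGreatest
      (Set.range
        (RWP.objective μ p ρ (fun ω => RWP.jacobian (fun w => h w θ) (W ω)) x))
      ((RWP.rbar μ p ρ (fun ω => RWP.jacobian (fun w => h w θ) (W ω)) x : ℝ) : EReal)) ∧
    (ρ = 1 → ∀ x, IsGreatest
      ((fun ζ => inner ℝ ζ x) ''
        RWP.admissible μ p (fun ω => RWP.jacobian (fun w => h w θ) (W ω)))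
      (RWP.rbar μ p ρ (fun ω => RWP.jacobian (fun w => h w θ) (W ω)) x)) ∧
    -- the covariance matrix is `E[h hᵀ]`
    (∀ i j, RWP.covMat μ (fun ω => h (W ω) θ) i j = ∫ ω, h (W ω) θ i * h (W ω) θ j ∂μ) ∧
    -- the asymptotic stochastic upper bound
    RWP.AsympStochLE μ ν
      (fun n ω => (n : ℝ) ^ (ρ / 2) * (RWP.rwp q ρ h (fun i => X i ω) n θ).toReal)
      (fun ω => RWP.rbar μ p ρ (fun ω' => RWP.jacobian (fun w => h w θ) (W ω')) (H ω)) := by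
  have : p.HolderConjugate q := RWP.holderConjugate_of_one_div hpq
  have : Fact (1 ≤ q) := ⟨hq⟩
  have hVm : Measurable fun ω => h (W ω) θ := hdiff.continuous.measurable.comp hW
  have hV : MemLp (fun ω => h (W ω) θ) 2 μ :=
    (memLp_two_iff_integrable_sq_norm hVm.aestronglyMeasurable).2 hsq
  have hL := RWP.response_surjective p q hW hdiff hnondeg
  have hrbar := RWP.rbar_eq_valueFn p q hρ hW hdiff hL
  have hcont := RWP.continuous_valueFn hL (RWP.convexOn_pertCost (μ := μ) hW q hρ) (RWP.pertCost_nonneg q ρ)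
  have hmeas : ∀ n, Measurable (fun ω => RWP.rwp q ρ h (fun i => X i ω) n θ) := fun n =>
    (RWP.measurable_profile_empirical q hρ (fun w => h w θ) n).comp (measurable_pi_lambda _ hX)
  have h0 := RWP.zero_mem_convexHull_range p q hdiff (hV.integrable one_le_two) hmean hnondeg
  refine ⟨hmeas, fun n hn ω => RWP.profile_empirical_ne_top q hρ h0 _ hn, ?_, ?_, ?_,
    RWP.covMat_apply_of_integral_eq_zero hV hmean, ?_⟩
  · rw [hrbar]
    exact hcont.measurable
  · intro hρ1 x
    rw [hrbar]
    exact RWP.isGreatest_objective p q hρ1 hW hdiff hL x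
  · rintro rfl x
    rw [hrbar]
    exact RWP.isGreatest_admissible p q hW hdiff hL x
  · simp only [hrbar]
    have hg : Measurable fun w => h w θ := hdiff.continuous.measurable
    refine RWP.asympStochLE_of_eventually_le
      (S := fun n ω => (√n)⁻¹ • ∑ i ∈ Finset.range n, h (X i ω) θ)
      (fun n => (hmeas n).ennreal_toReal.const_mul _)
      (fun n => (Finset.measurable_sum _ fun i _ => hg.comp (hX i)).const_smul (√n)⁻¹)
      hH.aemeasurable hcont (fun ε hε K hK => ?_) (fun φ => ?_)
    · exact RWP.ae_eventually_le_of_isCompact q hρ hindep hident hW hdiff hL hε hK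
    · exact RWP.tendsto_integral_inv_sqrt_smul_sum (Y := fun i ω => h (X i ω) θ)
        (hindep.comp (fun _ w => h w θ) fun _ => hg) (fun i => (hident i).comp hg) hV hmean hH φ
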